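/- All graphs are finite and simple. A graph is $k$-chordal if it has no induced cycle of length more than $k$, and cubic if all its vertices have degree $3$. $K_n$, $P_n$, $K_{n,m}$ denote the complete graph, the path and the complete bipartite graph, and $\Box$ the Cartesian product. Let $D$ be $K_4$ minus an edge, let $D'$ arise from $D$ by adding a new vertex joined to the two vertices of $D$ of degree $2$, and let $K_{3,3}^-$ be $K_{3,3}$ minus an edge. For $k\ge 2$ let $B_k=P_2\,\Box\,P_k$, let $B_k'$ arise from $B_k$ by adding a new vertex joined to two adjacent vertices of $B_k$ of degree $2$ that form an end copy of $P_2$ (for $k\geq 3$ every two adjacent vertices of degree $2$ do so, and for $k=2$ all choices give isomorphic graphs), and let $B_k''$ arise from $B_k'$ by adding a new vertex joined to the two adjacent vertices of $B_k'$ of degree $2$. Let $G$ be a connected cubic $4$-chordal graph. Then exactly one of the following holds: (i) $G$ is $2$-connected, and in this case $G$ is isomorphic to $K_4$, $K_{3,3}$ or $P_2\,\Box\,K_3$; (ii) $G$ arises from a tree $T$ of order at least $2$ and maximum degree at most $4$ by replacing every vertex of $T$ of degree $1$ with $D'$; every vertex of $T$ of degree $2$ with $D$, with $K_{3,3}^-$,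 or with $B_k''$ for some $k\ge 2$; some (possibly none, possibly all) of the vertices of $T$ of degree $3$ with $K_3$, with $K_{2,3}$, or with $B_k'$ for some $k\ge 2$; and every vertex of $T$ of degree $4$ with $B_k$ for some $k\ge 2$ (different vertices may be replaced with different graphs and different $k$). Here, replacing a vertex $t$ of $T$ with a graph $H_t$ means that the edges of $T$ incident with $t$ are attached to $H_t$ by a bijection between these edges and the vertices of degree $2$ of $H_t$; vertices of $T$ that are not replaced are kept as they are. -/

import Mathlib

open SimpleGraph

universe u

namespace CubicChordal

/-- `G` is `k`-chordal: no induced cycle of length more than `k`. -/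
def IsChordal {V : Type u} (k : ℕ) (G : SimpleGraph V) : Prop :=
  ∀ n : ℕ, 3 ≤ n → k < n → IsEmpty (cycleGraph n ↪g G)

/-- `G` is 2-connected: it has order at least 3, is connected, and stays connected
after the deletion of any single vertex. -/
def IsTwoConnected {V : Type u} (G : SimpleGraph V) : Prop :=
  3 ≤ Nat.card V ∧ G.Connected ∧ ∀ v : V, (G.induce ({v}ᶜ : Set V)).Connected

/-- The graph obtained from `H` by adding one new vertex `none` that is joined to exactly the
vertices in `S`. -/
def addVertex {U : Type} (H : SimpleGraph U) (S : Set U) : SimpleGraph (Option U) where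
  Adj
    | some x, some y => H.Adj x y
    | some x, none => x ∈ S
    | none, some y => y ∈ S
    | none, none => False
  symm := ⟨by
    rintro (_ | x) (_ | y) h
    · exact h
    · exact h
    · exact h
    · exact SimpleGraph.Adj.symm (G := H) h⟩
  loopless := ⟨by
    rintro (_ | x) h
    · exact h
    · exact H.loopless.irrefl x h⟩

/-- The diamond `D`, that is, `K₄` minus the edge `01`. -/
def diamond : SimpleGraph (Fin 4) :=
  (completeGraph (Fin 4)).deleteEdges {s(0, 1)}

/-- `D` with a new vertex joined to its two vertices of degree 2. -/
def diamondPlus : SimpleGraph (Option (Fin 4)) :=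
  addVertex diamond {0, 1}

/-- `K₃,₃` minus an edge. -/
def kThreeThreeMinus : SimpleGraph (Fin 3 ⊕ Fin 3) :=
  (completeBipartiteGraph (Fin 3) (Fin 3)).deleteEdges {s(Sum.inl 0, Sum.inr 0)}

/-- The ladder `P₂ □ Pₖ`, called `B k`. -/
def ladder (k : ℕ) : SimpleGraph (Fin 2 × Fin k) :=
  pathGraph 2 □ pathGraph k

/-- The ladder with a new vertex joined to the two ends of its first rung. -/
def ladderOne (k : ℕ) : SimpleGraph (Option (Fin 2 × Fin k)) :=
  addVertex (ladder k) {v | (v.2 : ℕ) = 0}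

/-- The previous graph with a further new vertex joined to the two ends of the last rung. -/
def ladderTwo (k : ℕ) : SimpleGraph (Option (Option (Fin 2 × Fin k))) :=
  addVertex (ladderOne k) {w | ∃ v : Fin 2 × Fin k, w = some v ∧ (v.2 : ℕ) + 1 = k}

/-- The graphs (up to isomorphism) by which a tree vertex of degree `d` may be replaced. -/
def IsReplacement {U : Type u} (d : ℕ) (H : SimpleGraph U) : Prop :=
  (d = 1 ∧ Nonempty (H ≃g diamondPlus)) ∨
  (d = 2 ∧ (Nonempty (H ≃g diamond) ∨ Nonempty (H ≃g kThreeThreeMinus) ∨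
    ∃ k : ℕ, 2 ≤ k ∧ Nonempty (H ≃g ladderTwo k))) ∨
  (d = 3 ∧ (Nonempty (H ≃g completeGraph (Fin 3)) ∨
    Nonempty (H ≃g completeBipartiteGraph (Fin 2) (Fin 3)) ∨
    ∃ k : ℕ, 2 ≤ k ∧ Nonempty (H ≃g ladderOne k))) ∨
  (d = 4 ∧ ∃ k : ℕ, 2 ≤ k ∧ Nonempty (H ≃g ladder k))

/-- Replace every vertex `t` of `T` by the graph `H t`; every edge `t t'` of `T` becomes one edge,
which joins the vertex `p t t'` of `H t` to the vertex `p t' t` of `H t'`.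
(The value of `p t t'` is irrelevant unless `t` and `t'` are adjacent in `T`.) -/
def substitute {W : Type u} (T : SimpleGraph W) {U : W → Type u}
    (H : (t : W) → SimpleGraph (U t)) (p : (t : W) → W → U t) :
    SimpleGraph (Σ t, U t) where
  Adj a b :=
    (∃ (t : W) (x y : U t), (H t).Adj x y ∧ a = ⟨t, x⟩ ∧ b = ⟨t, y⟩) ∨
    (T.Adj a.1 b.1 ∧ a.2 = p a.1 b.1 ∧ b.2 = p b.1 a.1)
  symm := ⟨by
    rintro a b (⟨t, x, y, h, ha, hb⟩ | ⟨h, ha, hb⟩)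
    · exact Or.inl ⟨t, y, x, h.symm, hb, ha⟩
    · exact Or.inr ⟨h.symm, hb, ha⟩⟩
  loopless := ⟨by
    rintro a (⟨t, x, y, h, ha, hb⟩ | ⟨h, -, -⟩)
    · rw [ha] at hb
      obtain rfl : x = y := by simpa using hb
      exact (H t).loopless.irrefl x h
    · exact T.loopless.irrefl _ h⟩

open Classical in
/-- `G` arises from a tree `T` of order at least 2 and maximum degree at most 4 by replacing
every vertex whose degree is not 3, and some of the vertices of degree 3, according to
`IsReplacement`. A vertex that is not replaced has degree 3 and stays a single vertex; the
edges of `T` at a replaced vertex `t` are attached, one each, to the vertices of degree 2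
of `H t`. -/
def ArisesFromTree {V : Type u} (G : SimpleGraph V) : Prop :=
  ∃ (W : Type u) (_ : Fintype W) (T : SimpleGraph W),
    T.IsTree ∧ 2 ≤ Fintype.card W ∧ T.maxDegree ≤ 4 ∧
    ∃ (U : W → Type u) (H : (t : W) → SimpleGraph (U t)) (p : (t : W) → W → U t),
      (∀ t : W,
        (T.degree t = 3 ∧ Nonempty (Unique (U t))) ∨
        (IsReplacement (T.degree t) (H t) ∧
          Set.BijOn (p t) (T.neighborSet t) {x | ((H t).neighborSet x).ncard = 2})) ∧
      Nonempty (G ≃g substitute T H p)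

end CubicChordal

namespace CubicChordal

/-! ### Short cycles through non-bridges, and closure arguments. -/

section ShortCycles

variable {V : Type u} {G : SimpleGraph V}

/-! The proof cuts `G` at its bridges and classifies what remains.

Local part. In a 4-chordal graph every edge that is not a bridge lies on a triangle or a 4-cycle: a
shortest detour around the edge closes up to an induced cycle (`exists_short_cycle`). Let `G` be
connected, bridgeless, subcubic and 4-chordal, with an edge, and take an induced ladder with the
maximum number `k` of rungs. If `k = 1`, there is no induced 4-cycle, so every edge is in a
triangle, which leaves the triangle, the diamond and `K₄`. If `k ≥ 3`, the interior of the ladder is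
saturated, an outer vertex cannot see both ends without creating a long induced cycle, and one that
sees a single corner would produce a longer ladder. Hence outer vertices sit as apexes over an end
rung (`EndAttached`), and `G` is a ladder with at most two apexes or the prism. If `k = 2`, an outer
vertex that sees two opposite vertices of the 4-cycle leads to `diamondPlus` or to the graphs around
`K₂,₃`; otherwise `EndAttached` holds again. The outcome is `isPiece_of_bridgeless`.

Global part. The components left after deleting all bridges are induced, connected and bridgeless,
and contracting them gives a tree. In a cubic graph a vertex of a nontrivial component is on at most
one bridge, and it is on one exactly when its degree in the component is 2. So the tree degree of a
component is its number of degree-2 vertices, which matches the degree prescribed by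
`IsReplacement`; single-vertex components are the tree vertices that are kept. Finally, a connected
cubic graph is 2-connected if and only if it has no bridge, and every edge of the tree yields a
bridge, so the two outcomes exclude each other. -/

theorem IsChordal.not_inducedCycle {k n : ℕ} (hch : IsChordal k G) (hn : 3 ≤ n) (hk : k < n)
    (f : ℕ → V) (hinj : ∀ i j, i < j → j < n → f i ≠ f j)
    (hadj : ∀ i j, i < j → j < n → (G.Adj (f i) (f j) ↔ j = i + 1 ∨ (i = 0 ∧ j + 1 = n))) :
    False := by
  have key : ∀ i j : Fin n, i < j → ((cycleGraph n).Adj i j ↔ G.Adj (f i) (f j)) := by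
    intro i j hij
    have h1 : (i : ℕ) < j := hij
    rw [hadj i j h1 j.2, cycleGraph_adj', Fin.coe_sub_iff_lt.2 hij, Fin.coe_sub_iff_le.2 hij.le]
    have := j.2
    omega
  refine (hch n hn hk).false ⟨⟨fun i => f i, ?_⟩, ?_⟩
  · intro i j hij
    rcases lt_trichotomy i j with h | h | h
    · exact (hinj i j h j.2 hij).elim
    · exact h
    · exact (hinj j i h i.2 hij.symm).elim
  · intro i j
    change G.Adj (f i) (f j) ↔ _
    rcases lt_trichotomy i j with h | h | h
    · exact (key i j h).symm
    · simp [h]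
    · rw [G.adj_comm, (cycleGraph n).adj_comm]; exact (key j i h).symm

theorem IsChordal.induce {k : ℕ} (hch : IsChordal k G) (S : Set V) : IsChordal k (G.induce S) :=
  fun n hn hk => ⟨fun e => (hch n hn hk).false (e.trans (Embedding.induce S))⟩

/-- In a 4-chordal graph, every edge that is not a bridge lies on a cycle of length 3 or 4. -/
theorem IsChordal.exists_short_cycle (hch : IsChordal 4 G) {a b : V} (hab : G.Adj a b)
    (hr : (G.deleteEdges {s(a, b)}).Reachable a b) :
    (∃ z, G.Adj a z ∧ G.Adj z b) ∨
      ∃ z w, G.Adj a z ∧ G.Adj z w ∧ G.Adj w b ∧ z ≠ b ∧ w ≠ a := by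
  set G' := G.deleteEdges {s(a, b)} with hG'
  obtain ⟨p, hp⟩ := hr.exists_walk_length_eq_dist
  set n := p.length with hn
  have hle : ∀ x y, G'.Adj x y → G.Adj x y := fun x y h => (deleteEdges_le _ : G' ≤ G) h
  have hshort : ∀ q : G'.Walk a b, n ≤ q.length := fun q => by rw [hp]; exact dist_le q
  have hstep : ∀ i, i < n → G'.Adj (p.getVert i) (p.getVert (i + 1)) :=
    fun i hi => p.adj_getVert_succ hi
  have h0 : p.getVert 0 = a := p.getVert_zero
  have h1 : p.getVert n = b := p.getVert_length
  -- A repeated vertex would allow a shortcut in the shortest path `p`.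
  have hinj : ∀ i j, i < j → j ≤ n → p.getVert i ≠ p.getVert j := by
    intro i j hij hj h
    have := hshort (((p.take i).copy rfl h).append (p.drop j))
    simp only [Walk.length_append, Walk.length_copy, Walk.take_length, Walk.drop_length] at this
    omega
  have hne : a ≠ b := hab.ne
  -- A chord other than `ab` survives in `G'` and would shorten `p`, so `p` together with `ab` is an
  -- induced cycle.
  have hchord : ∀ i j, i < j → j ≤ n →
      (G.Adj (p.getVert i) (p.getVert j) ↔ j = i + 1 ∨ (i = 0 ∧ j = n)) := by
    intro i j hij hj
    constructor
    · intro h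
      by_contra! hcon
      have h' : G'.Adj (p.getVert i) (p.getVert j) := by
        refine deleteEdges_adj.2 ⟨h, ?_⟩
        simp only [Set.mem_singleton_iff, Sym2.eq_iff, not_or, not_and]
        constructor
        · intro ha hb
          have hi0 : i = 0 := by
            by_contra hi
            exact hinj 0 i (by omega) (by omega) (h0.trans ha.symm)
          have := hcon.2 hi0
          exact hinj j n (by omega) le_rfl (hb.trans h1.symm)
        · intro hb ha
          exact hinj 0 j (by omega) hj (h0.trans ha.symm)
      have := hshort ((p.take i).append (.cons h' (p.drop j)))
      simp only [Walk.length_append, Walk.length_cons, Walk.take_length, Walk.drop_length] at this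
      omega
    · rintro (rfl | ⟨rfl, rfl⟩)
      · exact hle _ _ (hstep i (by omega))
      · rw [h0, h1]; exact hab
  have hn0 : n ≠ 0 := by
    intro h; rw [h, h0] at h1; exact hne h1
  have hn1 : n ≠ 1 := by
    intro h
    have := hstep 0 (by omega)
    rw [h0, zero_add, ← h, h1, hG', deleteEdges_adj] at this
    simp at this
  by_cases h4 : 4 ≤ n
  · exfalso
    -- The path has `n + 1` vertices, so `n ≥ 4` gives an induced cycle of length at least 5.
    refine hch.not_inducedCycle (n := n + 1) (by omega) (by omega) p.getVert
      (fun i j hij hj => hinj i j hij (by omega)) (fun i j hij hj => ?_)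
    rw [hchord i j hij (by omega)]
    omega
  · have : n = 2 ∨ n = 3 := by omega
    have e01 := hle _ _ (hstep 0 (by omega))
    have e12 := hle _ _ (hstep 1 (by omega))
    have d02 := hinj 0 2 (by omega) (by omega)
    rw [h0] at e01 d02
    rcases this with h | h
    · rw [h] at h1
      norm_num only at e12
      rw [h1] at e12
      exact Or.inl ⟨_, e01, e12⟩
    · have e23 := hle _ _ (hstep 2 (by omega))
      have d13 := hinj 1 3 (by omega) (by omega)
      rw [h] at h1
      norm_num only at e23
      rw [h1] at e23 d13
      exact Or.inr ⟨_, _, e01, e12, e23, d13, d02.symm⟩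

/-- A vertex `p` outside `S` with two neighbours in the same component of `G[S]` lies on a cycle
of length 3 or 4 in `G[S ∪ {p}]` through a prescribed one of these neighbours. -/
theorem IsChordal.exists_common (hch : IsChordal 4 G) {S : Set V} {p a b : V} (hp : p ∉ S)
    (ha : a ∈ S) (hb : b ∈ S) (hpa : G.Adj p a) (hpb : G.Adj p b) (hab : a ≠ b)
    (hr : (G.induce S).Reachable ⟨a, ha⟩ ⟨b, hb⟩) :
    ∃ c ∈ S, c ≠ a ∧ G.Adj p c ∧ (G.Adj a c ∨ ∃ d ∈ S, G.Adj a d ∧ G.Adj d c) := by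
  let S' : Set V := insert p S
  have hS : S ⊆ S' := Set.subset_insert _ _
  have hpS : p ∈ S' := Set.mem_insert _ _
  let a' : S' := ⟨a, hS ha⟩
  let b' : S' := ⟨b, hS hb⟩
  let p' : S' := ⟨p, hpS⟩
  have hadj : (G.induce S').Adj a' p' := hpa.symm
  have hpne : ∀ x : S, (⟨x, hS x.2⟩ : S') ≠ p' := by
    intro x hx
    have : (x : V) = p := congrArg Subtype.val hx
    exact hp (this ▸ x.2)
  let φ : G.induce S →g (G.induce S').deleteEdges {s(a', p')} :=
    ⟨fun x => ⟨x, hS x.2⟩, by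
      intro x y hxy
      rw [deleteEdges_adj]
      refine ⟨hxy, ?_⟩
      have h1 := hpne x
      have h2 := hpne y
      simp only [Set.mem_singleton_iff, Sym2.eq_iff]
      tauto⟩
  have hr' : ((G.induce S').deleteEdges {s(a', p')}).Reachable a' p' := by
    refine (hr.map φ).trans (Adj.reachable (v := p') ?_)
    rw [deleteEdges_adj]
    refine ⟨hpb.symm, ?_⟩
    simp only [Set.mem_singleton_iff, Sym2.eq_iff, not_or, not_and]
    constructor
    · intro h
      exact absurd (congrArg Subtype.val h).symm hab
    · intro h
      exact absurd h (hpne _)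
  have hmem : ∀ x : S', x ≠ p' → (x : V) ∈ S := by
    rintro ⟨x, hx⟩ hne
    rcases hx with rfl | hx
    · exact absurd rfl hne
    · exact hx
  rcases (hch.induce S').exists_short_cycle hadj hr' with ⟨z, h1, h2⟩ | ⟨z, w, h1, h2, h3, h4, h5⟩
  · exact ⟨z, hmem z h2.ne, fun h => h1.ne (Subtype.ext h.symm), h2.symm, Or.inl h1⟩
  · exact ⟨w, hmem w h3.ne, fun h => h5 (Subtype.ext h), h3.symm,
      Or.inr ⟨z, hmem z h4, h1, h2⟩⟩

/-- The way every classification step ends: once the listed vertices have no neighbours outside the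
list, the list is all of `G`. -/
theorem eq_univ_of_closed (hconn : G.Connected) {S : Set V} (hne : S.Nonempty)
    (hS : ∀ x ∈ S, ∀ y, G.Adj x y → y ∈ S) : S = Set.univ := by
  obtain ⟨x, hx⟩ := hne
  refine Set.eq_univ_of_forall fun y => ?_
  obtain ⟨w⟩ := hconn.preconnected x y
  induction w with
  | nil => exact hx
  | cons h _ ih => exact ih (hS _ hx _ h)

/-- Every vertex has at most three neighbours. -/
def Subcubic (G : SimpleGraph V) : Prop :=
  ∀ v a b c d, G.Adj v a → G.Adj v b → G.Adj v c → G.Adj v d → a ≠ b → a ≠ c → b ≠ c →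
    d = a ∨ d = b ∨ d = c

theorem subcubic_of_ncard_le [Finite V] (h : ∀ v, (G.neighborSet v).ncard ≤ 3) : Subcubic G := by
  intro v a b c d ha hb hc hd hab hac hbc
  by_contra! hcon
  have hsub : ({a, b, c, d} : Set V) ⊆ G.neighborSet v := by
    rintro x (rfl | rfl | rfl | rfl) <;> assumption
  have h1 := Set.ncard_le_ncard hsub (Set.toFinite _)
  have h2 : ({a, b, c, d} : Set V).ncard = 4 := by
    rw [Set.ncard_insert_of_notMem, Set.ncard_insert_of_notMem, Set.ncard_pair hcon.2.2.symm]
    · simp [hbc, hcon.2.1.symm]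
    · simp [hab, hac, hcon.1.symm]
  have := h v
  omega

/-- No edge of the graph is a bridge. -/
def Bridgeless (G : SimpleGraph V) : Prop :=
  ∀ a b, G.Adj a b → (G.deleteEdges {s(a, b)}).Reachable a b

end ShortCycles

/-! ### Induced ladders and how outer vertices attach to a maximum one. -/

section Ladders

variable {V : Type u} {G : SimpleGraph V}

/-- `f` is an induced embedding of the ladder with `k` rungs: `f s i` is the vertex of the
`i`-th rung in row `s`. -/
structure IsLadder (G : SimpleGraph V) (k : ℕ) (f : Bool → ℕ → V) : Prop where
  inj : ∀ s t i j, i < k → j < k → f s i = f t j → s = t ∧ i = j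
  adj : ∀ s t i j, i < k → j < k →
    (G.Adj (f s i) (f t j) ↔ (s = t ∧ (i + 1 = j ∨ j + 1 = i)) ∨ (s ≠ t ∧ i = j))

/-- The vertex `x` is not on the first `k` rungs. -/
def OffLadder (k : ℕ) (f : Bool → ℕ → V) (x : V) : Prop := ∀ s i, i < k → x ≠ f s i

/-- Reversing the order of the rungs turns statements about the first rung into statements about the
last. -/
theorem IsLadder.flip {k : ℕ} {f : Bool → ℕ → V} (h : IsLadder G k f) :
    IsLadder G k (fun s i => f s (k - 1 - i)) where
  inj s t i j hi hj he := by
    have := h.inj s t _ _ (by omega) (by omega) he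
    exact ⟨this.1, by omega⟩
  adj s t i j hi hj := by
    rw [h.adj s t _ _ (by omega) (by omega)]
    refine or_congr (and_congr_right fun _ => ?_) (and_congr_right fun _ => ?_) <;> omega

theorem OffLadder.flip {k : ℕ} {f : Bool → ℕ → V} {x : V} (h : OffLadder k f x) :
    OffLadder k (fun s i => f s (k - 1 - i)) x := fun s i hi => h s _ (by omega)

/-- The tool that contradicts maximality: `p` is a new rung appended after the last one. -/
theorem IsLadder.extend {k : ℕ} {f : Bool → ℕ → V} (h : IsLadder G k f) {p : Bool → V}
    (hp : ∀ s, OffLadder k f (p s)) (hpp : G.Adj (p false) (p true))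
    (hpf : ∀ s t i, i < k → (G.Adj (p s) (f t i) ↔ s = t ∧ i + 1 = k)) :
    IsLadder G (k + 1) (fun s i => if i = k then p s else f s i) where
  inj s t i j hi hj he := by
    split_ifs at he with h1 h2 h2
    · refine ⟨?_, h1.trans h2.symm⟩
      cases s <;> cases t
      · rfl
      · exact (hpp.ne he).elim
      · exact (hpp.ne he.symm).elim
      · rfl
    · exact (hp s t j (by omega) he).elim
    · exact (hp t s i (by omega) he.symm).elim
    · exact h.inj s t i j (by omega) (by omega) he
  adj s t i j hi hj := by
    split_ifs with h1 h2 h2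
    · subst h1 h2
      cases s <;> cases t <;> simp [hpp, hpp.symm]
    · rw [hpf s t j (by omega)]
      subst h1
      constructor
      · rintro ⟨rfl, h⟩; exact Or.inl ⟨rfl, Or.inr h⟩
      · rintro (⟨rfl, h⟩ | ⟨-, h⟩)
        · exact ⟨rfl, by omega⟩
        · omega
    · rw [G.adj_comm, hpf t s i (by omega)]
      subst h2
      constructor
      · rintro ⟨rfl, h⟩; exact Or.inl ⟨rfl, Or.inl h⟩
      · rintro (⟨rfl, h⟩ | ⟨-, h⟩)
        · exact ⟨rfl, by omega⟩
        · omega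
    · exact h.adj s t i j (by omega) (by omega)

theorem IsLadder.le_card [Finite V] {k : ℕ} {f : Bool → ℕ → V} (h : IsLadder G k f) :
    k ≤ Nat.card V := by
  have := Nat.card_le_card_of_injective (fun i : Fin k => f false i)
    (fun i j hij => Fin.ext (h.inj _ _ _ _ i.2 j.2 hij).2)
  simpa using this

theorem isLadder_one {a b : V} (h : G.Adj a b) :
    IsLadder G 1 (fun s _ => if s then b else a) where
  inj s t i j hi hj he := by
    refine ⟨?_, by omega⟩
    cases s <;> cases t <;> simp_all [h.ne, h.ne']
  adj s t i j hi hj := by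
    obtain rfl : i = 0 := by omega
    obtain rfl : j = 0 := by omega
    cases s <;> cases t <;> simp [h, h.symm]

theorem isLadder_two {a b c d : V} (hab : G.Adj a b) (hbc : G.Adj b c) (hcd : G.Adj c d)
    (hda : G.Adj d a) (hac : a ≠ c) (hbd : b ≠ d) (nac : ¬ G.Adj a c) (nbd : ¬ G.Adj b d) :
    IsLadder G 2 (fun s i => if i = 0 then (if s then b else a) else (if s then c else d)) where
  inj s t i j hi hj he := by
    have hi' : i = 0 ∨ i = 1 := by omega
    have hj' : j = 0 ∨ j = 1 := by omega
    have := hab.ne; have := hbc.ne; have := hcd.ne; have := hda.ne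
    rcases hi' with rfl | rfl <;> rcases hj' with rfl | rfl <;> cases s <;> cases t <;>
      simp_all
  adj s t i j hi hj := by
    have hi' : i = 0 ∨ i = 1 := by omega
    have hj' : j = 0 ∨ j = 1 := by omega
    have := hab.symm; have := hbc.symm; have := hcd.symm; have := hda.symm
    have nca : ¬ G.Adj c a := fun h => nac h.symm
    have ndb : ¬ G.Adj d b := fun h => nbd h.symm
    rcases hi' with rfl | rfl <;> rcases hj' with rfl | rfl <;> cases s <;> cases t <;>
      simp [*]

theorem exists_max_ladder [Finite V] {a b : V} (h : G.Adj a b) :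
    ∃ k f, 1 ≤ k ∧ IsLadder G k f ∧ ∀ f', ¬ IsLadder G (k + 1) f' := by
  classical
  let P : ℕ → Prop := fun k => ∃ f, IsLadder G k f
  have h1 : P 1 := ⟨_, isLadder_one h⟩
  have hle : 1 ≤ Nat.card V := isLadder_one h |>.le_card
  refine ⟨Nat.findGreatest P (Nat.card V), ?_⟩
  obtain ⟨f, hf⟩ : P (Nat.findGreatest P (Nat.card V)) := Nat.findGreatest_spec hle h1
  refine ⟨f, Nat.le_findGreatest hle h1, hf, fun f' hf' => ?_⟩
  have := Nat.le_findGreatest (P := P) hf'.le_card ⟨f', hf'⟩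
  omega

variable {k : ℕ} {f : Bool → ℕ → V}

theorem IsLadder.adj_succ (h : IsLadder G k f) (s : Bool) {i : ℕ} (hi : i + 1 < k) :
    G.Adj (f s i) (f s (i + 1)) := (h.adj _ _ _ _ (by omega) hi).2 (Or.inl ⟨rfl, Or.inl rfl⟩)

theorem IsLadder.adj_rung (h : IsLadder G k f) (s : Bool) {i : ℕ} (hi : i < k) :
    G.Adj (f s i) (f (!s) i) := (h.adj _ _ _ _ hi hi).2 (Or.inr ⟨by simp, rfl⟩)

theorem IsLadder.ne (h : IsLadder G k f) {s t : Bool} {i j : ℕ} (hi : i < k) (hj : j < k)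
    (hne : ¬ (s = t ∧ i = j)) : f s i ≠ f t j := fun he => hne (h.inj _ _ _ _ hi hj he)

/-- An interior vertex already has its three neighbours inside the ladder. -/
theorem IsLadder.eq_of_adj_interior (h : IsLadder G k f) (hsub : Subcubic G) {s : Bool} {i : ℕ}
    (hi : i + 2 < k) {x : V} (hx : G.Adj (f s (i + 1)) x) :
    x = f s i ∨ x = f s (i + 2) ∨ x = f (!s) (i + 1) :=
  hsub _ _ _ _ _ (h.adj_succ s (by omega)).symm (h.adj_succ s hi) (h.adj_rung s (by omega)) hx
    (h.ne (by omega) hi (by omega)) (h.ne (by omega) (by omega) (by simp))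
    (h.ne (by omega) (by omega) (by simp))

/-- A corner has two neighbours in the ladder, hence room for only one outer neighbour. -/
theorem IsLadder.eq_of_adj_first (h : IsLadder G k f) (hsub : Subcubic G) (hk : 2 ≤ k)
    {s : Bool} {p x : V} (hp : OffLadder k f p) (hsp : G.Adj (f s 0) p)
    (hx : G.Adj (f s 0) x) : x = p ∨ x = f s 1 ∨ x = f (!s) 0 :=
  hsub _ _ _ _ _ hsp (h.adj_succ s (by omega)) (h.adj_rung s (by omega)) hx
    (hp _ _ (by omega)) (hp _ _ (by omega)) (h.ne (by omega) (by omega) (by simp))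

theorem IsLadder.reachable_row (h : IsLadder G k f) {S : Set V} {s : Bool}
    (hS : ∀ i, i < k → f s i ∈ S) (h0 : 0 < k) : ∀ i (hi : i < k),
    (G.induce S).Reachable ⟨f s 0, hS 0 h0⟩ ⟨f s i, hS i hi⟩
  | 0, _ => .rfl
  | i + 1, hi => (h.reachable_row hS h0 i (by omega)).trans
      (Adj.reachable (h.adj_succ s hi))

theorem IsLadder.eq_end_of_adj (h : IsLadder G k f) (hsub : Subcubic G) {p : V}
    (hp : OffLadder k f p) (s : Bool) (i : ℕ) (hik : i < k) (ha : G.Adj p (f s i)) :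
    i = 0 ∨ i = k - 1 := by
  by_contra! hcon
  obtain ⟨j, rfl⟩ : ∃ j, i = j + 1 := ⟨i - 1, by omega⟩
  rcases h.eq_of_adj_interior hsub (by omega) ha.symm with h5 | h5 | h5
  · exact hp _ _ (by omega) h5
  · exact hp _ _ (by omega) h5
  · exact hp _ _ (by omega) h5

/-- An outer vertex of a long ladder is not joined to opposite corners. -/
theorem IsLadder.not_adj_opposite_aux (h : IsLadder G k f) (hch : IsChordal 4 G)
    (hk : 3 ≤ k) {p : V} (hp : OffLadder k f p)
    (hi : ∀ s i, i < k → G.Adj p (f s i) → i = 0 ∨ i = k - 1) {s : Bool}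
    (h1 : G.Adj p (f s 0)) (h2 : G.Adj p (f (!s) (k - 1))) (h3 : ¬ G.Adj p (f s (k - 1))) :
    False := by
  -- Inside `S` the vertex `p` sees only the two opposite corners, and these are at distance `k ≥
  -- 3`, too far apart for `exists_common`.
  let S : Set V := {x | (∃ i, i < k ∧ x = f s i) ∨ x = f (!s) (k - 1)}
  have hrow : ∀ i, i < k → f s i ∈ S := fun i hi => Or.inl ⟨i, hi, rfl⟩
  have hpS : p ∉ S := by
    rintro (⟨i, hik, rfl⟩ | rfl)
    · exact hp s i hik rfl
    · exact hp _ _ (by omega) rfl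
  have hr : (G.induce S).Reachable ⟨f s 0, hrow 0 (by omega)⟩ ⟨f (!s) (k - 1), Or.inr rfl⟩ :=
    (h.reachable_row hrow (by omega) (k - 1) (by omega)).trans
      (Adj.reachable (h.adj_rung s (by omega)))
  obtain ⟨c, hc, hca, hpc, hc2⟩ := hch.exists_common hpS _ _ h1 h2
    (h.ne (by omega) (by omega) (by simp)) hr
  obtain rfl : c = f (!s) (k - 1) := by
    rcases hc with ⟨i, hik, rfl⟩ | hc
    · rcases hi s i hik hpc with rfl | rfl
      · exact (hca rfl).elim
      · exact (h3 hpc).elim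
    · exact hc
  rcases hc2 with hc2 | ⟨d, hd, had, hdc⟩
  · rw [h.adj _ _ _ _ (by omega) (by omega)] at hc2
    simp at hc2; omega
  · rcases hd with ⟨i, hik, rfl⟩ | rfl
    · rw [h.adj _ _ _ _ (by omega) (by omega)] at had hdc
      simp at had hdc; omega
    · exact hdc.ne rfl

/-- A vertex joined to all four corners has too many neighbours; otherwise one of the other two
corners is missed, and the auxiliary lemma applies to the ladder or to its reversal. -/
theorem IsLadder.not_adj_opposite (h : IsLadder G k f) (hch : IsChordal 4 G) (hsub : Subcubic G)
    (hk : 3 ≤ k) {p : V} (hp : OffLadder k f p)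
    (hi : ∀ s i, i < k → G.Adj p (f s i) → i = 0 ∨ i = k - 1) {s : Bool}
    (h1 : G.Adj p (f s 0)) (h2 : G.Adj p (f (!s) (k - 1))) : False := by
  by_cases h3 : G.Adj p (f s (k - 1))
  · by_cases h4 : G.Adj p (f (!s) 0)
    · rcases hsub p _ _ _ _ h1 h2 h3 h4 (h.ne (by omega) (by omega) (by simp))
        (h.ne (by omega) (by omega) (by omega)) (h.ne (by omega) (by omega) (by simp)) with
        h5 | h5 | h5
      · simpa using h.inj _ _ _ _ (by omega) (by omega) h5
      · have := h.inj _ _ _ _ (by omega) (by omega) h5; omega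
      · simpa using h.inj _ _ _ _ (by omega) (by omega) h5
    · refine h.flip.not_adj_opposite_aux hch hk hp.flip (fun s i hik ha => ?_) (s := !s) ?_ ?_ ?_
      · have := hi s _ (by omega) ha; omega
      · simpa using h2
      · simpa using h1
      · simpa using h4
  · exact h.not_adj_opposite_aux hch hk hp hi h1 h2 h3

/-- An outer vertex of a long ladder is not joined to both ends of the ladder. -/
theorem IsLadder.not_adj_both_ends (h : IsLadder G k f) (hch : IsChordal 4 G) (hsub : Subcubic G)
    (hk : 3 ≤ k) {p : V} (hp : OffLadder k f p)
    (hi : ∀ s i, i < k → G.Adj p (f s i) → i = 0 ∨ i = k - 1) {s t : Bool}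
    (h1 : G.Adj p (f s 0)) (h2 : G.Adj p (f t (k - 1))) : False := by
  have hopp : ∀ s, G.Adj p (f s 0) → ¬ G.Adj p (f (!s) (k - 1)) :=
    fun s h1 h2 => h.not_adj_opposite hch hsub hk hp hi h1 h2
  by_cases hst : t = !s
  · subst hst; exact hopp s h1 h2
  obtain rfl : t = s := by cases s <;> cases t <;> simp_all
  have h3 : ¬ G.Adj p (f (!t) 0) := fun h3 => hopp _ h3 (by simpa using h2)
  have h4 := hopp _ h1
  -- The detour uses the other row, because `p` and row `t` alone would form an admissible 4-cycle
  -- when `k = 3`. In `S` the two corners are at distance `k + 1`.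
  let S : Set V := {x | (∃ i, i < k ∧ x = f (!t) i) ∨ x = f t 0 ∨ x = f t (k - 1)}
  have hrow : ∀ i, i < k → f (!t) i ∈ S := fun i hi => Or.inl ⟨i, hi, rfl⟩
  have hpS : p ∉ S := by
    rintro (⟨i, hik, rfl⟩ | rfl | rfl)
    · exact hp _ i hik rfl
    · exact hp _ _ (by omega) rfl
    · exact hp _ _ (by omega) rfl
  have hr : (G.induce S).Reachable ⟨f t 0, Or.inr (Or.inl rfl)⟩
      ⟨f t (k - 1), Or.inr (Or.inr rfl)⟩ :=
    (Adj.reachable (v := ⟨f (!t) 0, hrow 0 (by omega)⟩ ) (h.adj_rung t (by omega))).trans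
      ((h.reachable_row hrow (by omega) (k - 1) (by omega)).trans
      (Adj.reachable (h.adj_rung t (by omega)).symm))
  obtain ⟨c, hc, hca, hpc, hc2⟩ := hch.exists_common hpS _ _ h1 h2
    (h.ne (by omega) (by omega) (by omega)) hr
  obtain rfl : c = f t (k - 1) := by
    rcases hc with ⟨i, hik, rfl⟩ | hc | hc
    · rcases hi _ i hik hpc with rfl | rfl
      · exact (h3 hpc).elim
      · exact (h4 hpc).elim
    · exact (hca hc).elim
    · exact hc
  rcases hc2 with hc2 | ⟨d, hd, had, hdc⟩
  · rw [h.adj _ _ _ _ (by omega) (by omega)] at hc2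
    simp at hc2; omega
  · rcases hd with ⟨i, hik, rfl⟩ | rfl | rfl
    · rw [h.adj _ _ _ _ (by omega) (by omega)] at had hdc
      simp at had hdc; omega
    · exact had.ne rfl
    · exact hdc.ne rfl

/-- Every outer neighbour of the ladder is joined exactly to the two ends of the first rung or to
the two ends of the last rung. -/
def EndAttached (G : SimpleGraph V) (k : ℕ) (f : Bool → ℕ → V) : Prop :=
  ∀ p, OffLadder k f p → ∀ s i, i < k → G.Adj p (f s i) →
    (∀ t j, j < k → (G.Adj p (f t j) ↔ j = 0)) ∨ (∀ t j, j < k → (G.Adj p (f t j) ↔ j = k - 1))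

/-- The edge from `p` to the corner lies on a triangle or 4-cycle. If `p` misses the other corner,
saturation of the ladder leaves only a 4-cycle running along the first rung and through a new vertex
`w`; then `p` and `w` form a further rung. -/
theorem IsLadder.adj_rung_of_adj_first (h : IsLadder G k f) (hch : IsChordal 4 G)
    (hbr : Bridgeless G) (hsub : Subcubic G) (hk : 3 ≤ k) (hmax : ∀ f', ¬ IsLadder G (k + 1) f')
    {p : V} (hp : OffLadder k f p) {s : Bool} (h1 : G.Adj p (f s 0)) : G.Adj p (f (!s) 0) := by
  have hi : ∀ q, OffLadder k f q → ∀ s i, i < k → G.Adj q (f s i) → i = 0 ∨ i = k - 1 :=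
    fun q hq => h.eq_end_of_adj hsub hq
  have hi0 : ∀ q, OffLadder k f q → ∀ s t i, i < k → G.Adj q (f s 0) → G.Adj q (f t i) →
      i = 0 := by
    intro q hq s t i hik h1 h2
    rcases hi q hq t i hik h2 with h3 | rfl
    · exact h3
    · exact (h.not_adj_both_ends hch hsub hk hq (hi q hq) h1 h2).elim
  by_contra hcon
  rcases hch.exists_short_cycle h1.symm (hbr _ _ h1.symm) with
    ⟨z, hz1, hz2⟩ | ⟨z, w, hz, hzw, hw, hzp, hws⟩
  · rcases h.eq_of_adj_first hsub (by omega) hp h1.symm hz1 with rfl | rfl | rfl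
    · exact hz2.ne rfl
    · have := hi0 p hp _ _ 1 (by omega) h1 hz2.symm; omega
    · exact hcon hz2.symm
  · rcases h.eq_of_adj_first hsub (by omega) hp h1.symm hz with rfl | rfl | rfl
    · exact hzp rfl
    · rcases h.eq_of_adj_interior hsub (by omega) hzw with rfl | rfl | rfl
      · exact hws rfl
      · have := hi0 p hp _ _ _ (by omega) h1 hw.symm; omega
      · have := hi0 p hp _ _ _ (by omega) h1 hw.symm; omega
    · by_cases hwl : OffLadder k f w
      · have hwp := hw.ne
        -- The new rung precedes the first one, while `extend` appends at the end, so the ladder is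
        -- reversed.
        refine hmax _ (h.flip.extend (p := fun t => if t = s then p else w) ?_ ?_ ?_)
        · intro t
          split_ifs
          · exact hp.flip
          · exact hwl.flip
        · cases s
          · simpa using hw.symm
          · simpa using hw
        · intro t t' i hik
          split_ifs with hts
          · subst hts
            constructor
            · intro ha
              have := hi0 p hp _ _ _ (by omega) h1 ha
              rw [this] at ha
              refine ⟨?_, by omega⟩
              by_contra hne
              obtain rfl : t' = !t := by cases t <;> cases t' <;> simp_all
              exact hcon ha
            · rintro ⟨rfl, hik'⟩
              obtain rfl : i = k - 1 := by omega
              simpa using h1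
          · obtain rfl : t = !s := by cases t <;> cases s <;> simp_all
            constructor
            · intro ha
              have := hi0 w hwl _ _ _ (by omega) hzw.symm ha
              rw [this] at ha
              refine ⟨?_, by omega⟩
              by_contra hne
              obtain rfl : t' = s := by cases s <;> cases t' <;> simp_all
              rcases h.eq_of_adj_first hsub (by omega) hp h1.symm ha.symm with h5 | h5 | h5
              · exact hwp h5
              · exact hwl _ _ (by omega) h5
              · exact hwl _ _ (by omega) h5
            · rintro ⟨rfl, hik'⟩
              obtain rfl : i = k - 1 := by omega
              simpa using hzw.symm
      · simp only [OffLadder, not_forall, not_not] at hwl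
        obtain ⟨t, i, hik, rfl⟩ := hwl
        have := hi0 p hp _ _ _ hik h1 hw.symm
        subst this
        rw [h.adj _ _ _ _ (by omega) (by omega)] at hzw
        have : t = s := by cases s <;> cases t <;> simp_all
        subst this
        exact hws rfl

theorem IsLadder.endAttached_aux (h : IsLadder G k f) (hch : IsChordal 4 G)
    (hbr : Bridgeless G) (hsub : Subcubic G) (hk : 3 ≤ k) (hmax : ∀ f', ¬ IsLadder G (k + 1) f')
    {p : V} (hp : OffLadder k f p) {s : Bool} (h1 : G.Adj p (f s 0)) :
    ∀ t j, j < k → (G.Adj p (f t j) ↔ j = 0) := by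
  have hi := h.eq_end_of_adj hsub hp
  intro t j hj
  constructor
  · intro ha
    rcases hi t j hj ha with h3 | rfl
    · exact h3
    · exact (h.not_adj_both_ends hch hsub hk hp hi h1 ha).elim
  · rintro rfl
    by_cases hts : t = s
    · subst hts; exact h1
    · obtain rfl : t = !s := by cases t <;> cases s <;> simp_all
      exact h.adj_rung_of_adj_first hch hbr hsub hk hmax hp h1

theorem IsLadder.endAttached (h : IsLadder G k f) (hch : IsChordal 4 G)
    (hbr : Bridgeless G) (hsub : Subcubic G) (hk : 3 ≤ k) (hmax : ∀ f', ¬ IsLadder G (k + 1) f') :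
    EndAttached G k f := by
  intro p hp s i hik ha
  have hi := h.eq_end_of_adj hsub hp s i hik ha
  rcases hi with rfl | rfl
  · exact Or.inl (h.endAttached_aux hch hbr hsub hk hmax hp ha)
  · refine Or.inr fun t j hj => ?_
    have := h.flip.endAttached_aux hch hbr hsub hk hmax hp.flip (s := s) (by simpa using ha)
      t (k - 1 - j) (by omega)
    rw [show k - 1 - (k - 1 - j) = j by omega] at this
    rw [this]
    omega

end Ladders

/-! ### Recognising the ladder families and counting their vertices of degree 2. -/

section LadderFamilies

variable {V : Type u} {G : SimpleGraph V}

/-- The number of vertices of degree 2. -/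
noncomputable def numDegTwo (G : SimpleGraph V) : ℕ := {x | (G.neighborSet x).ncard = 2}.ncard

theorem nonempty_iso_of_bijective {U : Type} {L : SimpleGraph U} (g : U → V)
    (hinj : Function.Injective g) (hsurj : Function.Surjective g)
    (hadj : ∀ x y, G.Adj (g x) (g y) ↔ L.Adj x y) : Nonempty (G ≃g L) :=
  ⟨(⟨Equiv.ofBijective g ⟨hinj, hsurj⟩, fun {x y} => hadj x y⟩ : L ≃g G).symm⟩

theorem ncard_neighborSet_eq_two {x a b : V} (hab : a ≠ b)
    (h : ∀ y, G.Adj x y ↔ y = a ∨ y = b) : (G.neighborSet x).ncard = 2 := by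
  have : G.neighborSet x = {a, b} := by ext y; simp [h]
  rw [this, Set.ncard_pair hab]

theorem ncard_neighborSet_ne_two [Finite V] {x a b c : V} (ha : G.Adj x a) (hb : G.Adj x b)
    (hc : G.Adj x c) (hab : a ≠ b) (hac : a ≠ c) (hbc : b ≠ c) :
    (G.neighborSet x).ncard ≠ 2 := by
  have hsub : ({a, b, c} : Set V) ⊆ G.neighborSet x := by
    rintro y (rfl | rfl | rfl) <;> assumption
  have h1 := Set.ncard_le_ncard hsub (Set.toFinite _)
  rw [Set.ncard_eq_three.2 ⟨a, b, c, hab, hac, hbc, rfl⟩] at h1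
  omega

variable {k : ℕ} {f : Bool → ℕ → V}

theorem OffLadder.not_iff {x : V} : ¬ OffLadder k f x ↔ ∃ s i, i < k ∧ x = f s i := by
  simp only [OffLadder, not_forall, not_not, exists_prop, ne_eq]

theorem OffLadder.of_flip {x : V} (h : OffLadder k (fun s i => f s (k - 1 - i)) x) :
    OffLadder k f x := by
  intro s i hi
  have := h s (k - 1 - i) (by omega)
  dsimp only at this
  rwa [show k - 1 - (k - 1 - i) = i by omega] at this

/-- Identifies the rows of `ladder`, indexed by `Fin 2`, with the Boolean rows of `IsLadder`. -/
theorem fin_two_beq_inj {x y : Fin 2} : ((x == 1) = (y == 1)) ↔ x = y := by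
  revert x y; decide

theorem IsLadder.adj_iff_ladder_adj (h : IsLadder G k f) (x y : Fin 2 × Fin k) :
    G.Adj (f (x.1 == 1) x.2) (f (y.1 == 1) y.2) ↔ (ladder k).Adj x y := by
  rw [h.adj _ _ _ _ x.2.2 y.2.2, ladder, boxProd_adj, pathGraph_adj, pathGraph_adj,
    fin_two_beq_inj, ne_eq, fin_two_beq_inj, Fin.ext_iff, Fin.ext_iff]
  have := x.1.2
  have := y.1.2
  omega

theorem IsLadder.injective (h : IsLadder G k f) :
    Function.Injective (fun x : Fin 2 × Fin k => f (x.1 == 1) x.2) := by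
  rintro ⟨x, i⟩ ⟨y, j⟩ he
  have := h.inj _ _ _ _ i.2 j.2 he
  exact Prod.ext (fin_two_beq_inj.1 this.1) (Fin.ext this.2)

theorem exists_fin_of_not_offLadder {x : V} (hx : ¬ OffLadder k f x) :
    ∃ y : Fin 2 × Fin k, f (y.1 == 1) y.2 = x := by
  obtain ⟨s, i, hi, rfl⟩ := OffLadder.not_iff.1 hx
  cases s
  · exact ⟨(0, ⟨i, hi⟩), rfl⟩
  · exact ⟨(1, ⟨i, hi⟩), rfl⟩

theorem IsLadder.nonempty_iso_ladder (h : IsLadder G k f) (hall : ∀ x, ¬ OffLadder k f x) :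
    Nonempty (G ≃g ladder k) :=
  nonempty_iso_of_bijective _ h.injective (fun x => exists_fin_of_not_offLadder (hall x))
    h.adj_iff_ladder_adj

theorem IsLadder.nonempty_iso_ladderOne (h : IsLadder G k f) {t : V} (ht : OffLadder k f t)
    (hta : ∀ s i, i < k → (G.Adj t (f s i) ↔ i = 0)) (hall : ∀ x, OffLadder k f x → x = t) :
    Nonempty (G ≃g ladderOne k) := by
  refine nonempty_iso_of_bijective
    (fun x : Option (Fin 2 × Fin k) => x.elim t (fun y => f (y.1 == 1) y.2)) ?_ ?_ ?_
  · rintro (_ | x) (_ | y) he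
    · rfl
    · exact (ht _ _ y.2.2 he).elim
    · exact (ht _ _ x.2.2 he.symm).elim
    · exact congrArg some (h.injective he)
  · intro x
    by_cases hx : OffLadder k f x
    · exact ⟨none, (hall x hx).symm⟩
    · obtain ⟨y, hy⟩ := exists_fin_of_not_offLadder hx
      exact ⟨some y, hy⟩
  · rintro (_ | x) (_ | y)
    · exact iff_of_false (G.irrefl) id
    · exact hta _ _ y.2.2
    · exact (G.adj_comm _ _).trans (hta _ _ x.2.2)
    · exact h.adj_iff_ladder_adj x y

theorem IsLadder.nonempty_iso_ladderTwo (h : IsLadder G k f) {t r : V} (ht : OffLadder k f t)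
    (hta : ∀ s i, i < k → (G.Adj t (f s i) ↔ i = 0)) (hr : OffLadder k f r)
    (hra : ∀ s i, i < k → (G.Adj r (f s i) ↔ i = k - 1)) (htr : t ≠ r) (ntr : ¬ G.Adj t r)
    (hall : ∀ x, OffLadder k f x → x = t ∨ x = r) :
    Nonempty (G ≃g ladderTwo k) := by
  have hra' : ∀ y : Fin 2 × Fin k, G.Adj r (f (y.1 == 1) y.2) ↔
      ∃ v : Fin 2 × Fin k, some y = some v ∧ (v.2 : ℕ) + 1 = k := by
    intro y
    rw [hra _ _ y.2.2]
    have := y.2.2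
    constructor
    · intro h; exact ⟨y, rfl, by omega⟩
    · rintro ⟨v, hv, h⟩
      cases hv; omega
  refine nonempty_iso_of_bijective (fun x : Option (Option (Fin 2 × Fin k)) =>
    x.elim r (fun x => x.elim t (fun y => f (y.1 == 1) y.2))) ?_ ?_ ?_
  · rintro (_ | _ | x) (_ | _ | y) he
    · rfl
    · exact (htr he.symm).elim
    · exact (hr _ _ y.2.2 he).elim
    · exact (htr he).elim
    · rfl
    · exact (ht _ _ y.2.2 he).elim
    · exact (hr _ _ x.2.2 he.symm).elim
    · exact (ht _ _ x.2.2 he.symm).elim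
    · exact congrArg (some ∘ some) (h.injective he)
  · intro x
    by_cases hx : OffLadder k f x
    · rcases hall x hx with rfl | rfl
      · exact ⟨some none, rfl⟩
      · exact ⟨none, rfl⟩
    · obtain ⟨y, hy⟩ := exists_fin_of_not_offLadder hx
      exact ⟨some (some y), hy⟩
  · rintro (_ | _ | x) (_ | _ | y)
    · exact iff_of_false (G.irrefl) id
    · refine iff_of_false (fun h => ntr h.symm) ?_
      rintro ⟨v, hv, -⟩
      cases hv
    · exact hra' y
    · refine iff_of_false ntr ?_
      rintro ⟨v, hv, -⟩
      cases hv
    · exact iff_of_false (G.irrefl) id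
    · exact hta _ _ y.2.2
    · exact (G.adj_comm _ _).trans (hra' x)
    · exact (G.adj_comm _ _).trans (hta _ _ x.2.2)
    · exact h.adj_iff_ladder_adj x y

theorem IsLadder.ncard_neighborSet_first (h : IsLadder G k f) (hk : 2 ≤ k) (s : Bool)
    (ho : ∀ p, OffLadder k f p → ¬ G.Adj p (f s 0)) : (G.neighborSet (f s 0)).ncard = 2 := by
  refine ncard_neighborSet_eq_two (a := f s 1) (b := f (!s) 0)
    (h.ne (by omega) (by omega) (by simp)) fun y => ⟨fun hy => ?_, ?_⟩
  · by_cases hyo : OffLadder k f y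
    · exact (ho y hyo hy.symm).elim
    · obtain ⟨t, i, hi, rfl⟩ := OffLadder.not_iff.1 hyo
      rw [h.adj _ _ _ _ (by omega) hi] at hy
      rcases hy with ⟨rfl, hy⟩ | ⟨hst, rfl⟩
      · obtain rfl : i = 1 := by omega
        exact Or.inl rfl
      · obtain rfl : t = !s := by cases s <;> cases t <;> simp_all
        exact Or.inr rfl
  · rintro (rfl | rfl)
    · exact h.adj_succ s (by omega)
    · exact h.adj_rung s (by omega)

theorem IsLadder.ncard_neighborSet_last (h : IsLadder G k f) (hk : 2 ≤ k) (s : Bool)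
    (ho : ∀ p, OffLadder k f p → ¬ G.Adj p (f s (k - 1))) :
    (G.neighborSet (f s (k - 1))).ncard = 2 := by
  refine h.flip.ncard_neighborSet_first hk s fun p hp => ?_
  exact ho p hp.of_flip

theorem IsLadder.ncard_neighborSet_first_ne [Finite V] (h : IsLadder G k f) (hk : 2 ≤ k) (s : Bool)
    {p : V} (hp : OffLadder k f p) (ha : G.Adj p (f s 0)) : (G.neighborSet (f s 0)).ncard ≠ 2 :=
  ncard_neighborSet_ne_two ha.symm (h.adj_succ s (by omega)) (h.adj_rung s (by omega))
    (hp _ _ (by omega)) (hp _ _ (by omega)) (h.ne (by omega) (by omega) (by simp))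

theorem IsLadder.ncard_neighborSet_last_ne [Finite V] (h : IsLadder G k f) (hk : 2 ≤ k) (s : Bool)
    {p : V} (hp : OffLadder k f p) (ha : G.Adj p (f s (k - 1))) :
    (G.neighborSet (f s (k - 1))).ncard ≠ 2 :=
  h.flip.ncard_neighborSet_first_ne hk s hp.flip ha

theorem IsLadder.ncard_neighborSet_interior_ne [Finite V] (h : IsLadder G k f) (s : Bool) {i : ℕ}
    (hi : i < k) (h0 : i ≠ 0) (h1 : i ≠ k - 1) : (G.neighborSet (f s i)).ncard ≠ 2 := by
  obtain ⟨j, rfl⟩ : ∃ j, i = j + 1 := ⟨i - 1, by omega⟩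
  exact ncard_neighborSet_ne_two (h.adj_succ s (by omega)).symm
    (h.adj_succ s (i := j + 1) (by omega)) (h.adj_rung s (by omega))
    (h.ne (by omega) (by omega) (by omega)) (h.ne (by omega) (by omega) (by simp))
    (h.ne (by omega) (by omega) (by simp))

/-- Only the four corners have degree 2. This count, like its analogues with one and two apexes, is
the degree `d` required by `IsReplacement`. -/
theorem IsLadder.numDegTwo_ladder [Finite V] (h : IsLadder G k f) (hk : 2 ≤ k)
    (hall : ∀ x, ¬ OffLadder k f x) : numDegTwo G = 4 := by
  have : {x | (G.neighborSet x).ncard = 2} =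
      {f false 0, f true 0, f false (k - 1), f true (k - 1)} := by
    ext x
    simp only [Set.mem_ofPred_eq, Set.mem_insert_iff, Set.mem_singleton_iff]
    constructor
    · intro hx
      obtain ⟨s, i, hi, rfl⟩ := OffLadder.not_iff.1 (hall x)
      by_cases h0 : i = 0
      · subst h0; cases s <;> simp
      by_cases h1 : i = k - 1
      · subst h1; cases s <;> simp
      exact (h.ncard_neighborSet_interior_ne s hi h0 h1 hx).elim
    · rintro (rfl | rfl | rfl | rfl)
      · exact h.ncard_neighborSet_first hk _ fun p hp => (hall p hp).elim
      · exact h.ncard_neighborSet_first hk _ fun p hp => (hall p hp).elim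
      · exact h.ncard_neighborSet_last hk _ fun p hp => (hall p hp).elim
      · exact h.ncard_neighborSet_last hk _ fun p hp => (hall p hp).elim
  rw [numDegTwo, this, Set.ncard_insert_of_notMem, Set.ncard_eq_three.2
    ⟨_, _, _, h.ne (by omega) (by omega) (by simp), h.ne (by omega) (by omega) (by simp; omega),
      h.ne (by omega) (by omega) (by simp), rfl⟩]
  simp only [Set.mem_insert_iff, Set.mem_singleton_iff, not_or]
  exact ⟨h.ne (by omega) (by omega) (by simp), h.ne (by omega) (by omega) (by simp; omega),
    h.ne (by omega) (by omega) (by simp)⟩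

theorem ncard_neighborSet_apex (h : IsLadder G k f) (hk : 2 ≤ k) {t : V}
    (hta : ∀ s i, i < k → (G.Adj t (f s i) ↔ i = 0))
    (hto : ∀ x, OffLadder k f x → ¬ G.Adj t x) : (G.neighborSet t).ncard = 2 := by
  refine ncard_neighborSet_eq_two (a := f false 0) (b := f true 0)
    (h.ne (by omega) (by omega) (by simp)) fun y => ⟨fun hy => ?_, ?_⟩
  · by_cases hyo : OffLadder k f y
    · exact (hto y hyo hy).elim
    · obtain ⟨s, i, hi, rfl⟩ := OffLadder.not_iff.1 hyo
      obtain rfl := (hta _ _ hi).1 hy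
      cases s <;> simp
  · rintro (rfl | rfl) <;> exact (hta _ _ (by omega)).2 rfl

theorem IsLadder.numDegTwo_ladderOne [Finite V] (h : IsLadder G k f) (hk : 2 ≤ k) {t : V}
    (ht : OffLadder k f t) (hta : ∀ s i, i < k → (G.Adj t (f s i) ↔ i = 0))
    (hall : ∀ x, OffLadder k f x → x = t) : numDegTwo G = 3 := by
  have : {x | (G.neighborSet x).ncard = 2} = {t, f false (k - 1), f true (k - 1)} := by
    ext x
    simp only [Set.mem_ofPred_eq, Set.mem_insert_iff, Set.mem_singleton_iff]
    have hlast : ∀ s, (G.neighborSet (f s (k - 1))).ncard = 2 := fun s =>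
      h.ncard_neighborSet_last hk _ fun p hp ha => by
        obtain rfl := hall p hp
        have := (hta _ _ (by omega)).1 ha
        omega
    constructor
    · intro hx
      by_cases hxo : OffLadder k f x
      · exact Or.inl (hall x hxo)
      obtain ⟨s, i, hi, rfl⟩ := OffLadder.not_iff.1 hxo
      by_cases h0 : i = 0
      · subst h0
        exact (h.ncard_neighborSet_first_ne hk s ht ((hta s 0 hi).2 rfl) hx).elim
      by_cases h1 : i = k - 1
      · subst h1; cases s <;> simp
      exact (h.ncard_neighborSet_interior_ne s hi h0 h1 hx).elim
    · rintro (rfl | rfl | rfl)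
      · exact ncard_neighborSet_apex h hk hta fun y hy hty => hty.ne (hall y hy).symm
      · exact hlast _
      · exact hlast _
  rw [numDegTwo, this]
  exact Set.ncard_eq_three.2 ⟨_, _, _, ht _ _ (by omega), ht _ _ (by omega),
    h.ne (by omega) (by omega) (by simp), rfl⟩

theorem IsLadder.numDegTwo_ladderTwo [Finite V] (h : IsLadder G k f) (hk : 2 ≤ k) {t r : V}
    (ht : OffLadder k f t) (hta : ∀ s i, i < k → (G.Adj t (f s i) ↔ i = 0))
    (hr : OffLadder k f r) (hra : ∀ s i, i < k → (G.Adj r (f s i) ↔ i = k - 1)) (htr : t ≠ r)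
    (ntr : ¬ G.Adj t r) (hall : ∀ x, OffLadder k f x → x = t ∨ x = r) : numDegTwo G = 2 := by
  have : {x | (G.neighborSet x).ncard = 2} = {t, r} := by
    ext x
    simp only [Set.mem_ofPred_eq, Set.mem_insert_iff, Set.mem_singleton_iff]
    constructor
    · intro hx
      by_cases hxo : OffLadder k f x
      · exact hall x hxo
      obtain ⟨s, i, hi, rfl⟩ := OffLadder.not_iff.1 hxo
      by_cases h0 : i = 0
      · subst h0
        exact (h.ncard_neighborSet_first_ne hk s ht ((hta s 0 hi).2 rfl) hx).elim
      by_cases h1 : i = k - 1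
      · subst h1
        exact (h.ncard_neighborSet_last_ne hk s hr ((hra s _ hi).2 rfl) hx).elim
      exact (h.ncard_neighborSet_interior_ne s hi h0 h1 hx).elim
    · rintro (rfl | rfl)
      · refine ncard_neighborSet_apex h hk hta fun y hy hty => ?_
        rcases hall y hy with rfl | rfl
        · exact hty.ne rfl
        · exact ntr hty
      · refine ncard_neighborSet_apex h.flip hk (fun s i hi => ?_) fun y hy hty => ?_
        · rw [hra _ _ (by omega)]; omega
        · rcases hall y hy.of_flip with rfl | rfl
          · exact ntr hty.symm
          · exact hty.ne rfl
  rw [numDegTwo, this, Set.ncard_pair htr]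

end LadderFamilies

/-! ### Graphs in which all outer neighbours of a ladder are apexes of end rungs. -/

section LongLadders

variable {V : Type u} {G : SimpleGraph V} {k : ℕ} {f : Bool → ℕ → V}

/-- The possible structures of a connected bridgeless subcubic 4-chordal graph with an edge. -/
def IsPiece (G : SimpleGraph V) : Prop :=
  IsReplacement (numDegTwo G) G ∨ Nonempty (G ≃g completeGraph (Fin 4)) ∨
    Nonempty (G ≃g completeBipartiteGraph (Fin 3) (Fin 3)) ∨
    Nonempty (G ≃g pathGraph 2 □ completeGraph (Fin 3))

theorem EndAttached.flip (h : EndAttached G k f) :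
    EndAttached G k (fun s i => f s (k - 1 - i)) := by
  intro p hp s i hik ha
  rcases h p hp.of_flip s _ (by omega) ha with h1 | h1
  · refine Or.inr fun t j hj => ?_
    rw [h1 t _ (by omega)]; omega
  · refine Or.inl fun t j hj => ?_
    rw [h1 t _ (by omega)]; omega

/-- A triangle or 4-cycle through `tr` must leave the apex `t` through a corner `f s 0`, and since
the first rung is saturated it continues through `f s 1` to `r`. For `k ≥ 3` that vertex is interior
and saturated too. So an apex has a further neighbour only in the situation that yields the prism.
-/
theorem IsLadder.adj_of_adj_apex (h : IsLadder G k f) (hch : IsChordal 4 G)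
    (hbr : Bridgeless G) (hsub : Subcubic G) (hk : 2 ≤ k) {t r : V} (ht : OffLadder k f t)
    (hta : ∀ s i, i < k → (G.Adj t (f s i) ↔ i = 0)) (hr : OffLadder k f r) (htr : G.Adj t r) :
    k = 2 ∧ ∃ s, G.Adj r (f s 1) := by
  have hsat : ∀ z, G.Adj t z → z = r ∨ ∃ s, z = f s 0 := by
    intro z hz
    rcases hsub t _ _ _ z htr ((hta false 0 (by omega)).2 rfl) ((hta true 0 (by omega)).2 rfl) hz
      (hr _ _ (by omega)) (hr _ _ (by omega)) (h.ne (by omega) (by omega) (by simp))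
      with h1 | h1 | h1
    · exact Or.inl h1
    · exact Or.inr ⟨_, h1⟩
    · exact Or.inr ⟨_, h1⟩
  have hr0 : ∀ s, ¬ G.Adj (f s 0) r := by
    intro s hs
    rcases h.eq_of_adj_first hsub hk ht ((hta s 0 (by omega)).2 rfl).symm hs with h1 | h1 | h1
    · exact htr.ne h1.symm
    · exact hr _ _ (by omega) h1
    · exact hr _ _ (by omega) h1
  rcases hch.exists_short_cycle htr (hbr _ _ htr) with ⟨z, h1, h2⟩ | ⟨z, w, h1, h2, h3, h4, h5⟩
  · rcases hsat z h1 with rfl | ⟨s, rfl⟩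
    · exact (h2.ne rfl).elim
    · exact (hr0 s h2).elim
  · rcases hsat z h1 with rfl | ⟨s, rfl⟩
    · exact (h4 rfl).elim
    · rcases h.eq_of_adj_first hsub hk ht h1.symm h2 with rfl | rfl | rfl
      · exact (h5 rfl).elim
      · refine ⟨?_, s, h3.symm⟩
        by_contra hk2
        rcases h.eq_of_adj_interior hsub (by omega) h3 with h6 | h6 | h6
        · exact hr _ _ (by omega) h6
        · exact hr _ _ (by omega) h6
        · exact hr _ _ (by omega) h6
      · exact (hr0 _ h3).elim

theorem IsLadder.nonempty_iso_prism (h : IsLadder G 2 f) {t r : V} (ht : OffLadder 2 f t)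
    (hta : ∀ s i, i < 2 → (G.Adj t (f s i) ↔ i = 0)) (hr : OffLadder 2 f r)
    (hra : ∀ s i, i < 2 → (G.Adj r (f s i) ↔ i = 1)) (htr : G.Adj t r)
    (hall : ∀ x, OffLadder 2 f x → x = t ∨ x = r) :
    Nonempty (G ≃g pathGraph 2 □ completeGraph (Fin 3)) := by
  have hta0 := fun s => (hta s 0 (by omega)).2 rfl
  have hta1 : ∀ s, ¬ G.Adj t (f s 1) := fun s h => absurd ((hta s 1 (by omega)).1 h) (by omega)
  have hra1 := fun s => (hra s 1 (by omega)).2 rfl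
  have hra0 : ∀ s, ¬ G.Adj r (f s 0) := fun s h => absurd ((hra s 0 (by omega)).1 h) (by omega)
  have hta0' := fun s => (hta0 s).symm
  have hra1' := fun s => (hra1 s).symm
  have hta1' : ∀ s, ¬ G.Adj (f s 1) t := fun s h => hta1 s h.symm
  have hra0' : ∀ s, ¬ G.Adj (f s 0) r := fun s h => hra0 s h.symm
  have htn0 := fun s => ht s 0 (by omega)
  have htn1 := fun s => ht s 1 (by omega)
  have hrn0 := fun s => hr s 0 (by omega)
  have hrn1 := fun s => hr s 1 (by omega)
  have hinj : ∀ s t i j, i < 2 → j < 2 → (f s i = f t j ↔ s = t ∧ i = j) := fun s t i j hi hj =>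
    ⟨h.inj s t i j hi hj, fun ⟨h1, h2⟩ => by rw [h1, h2]⟩
  -- The two triangles of the prism are the two rungs, each with its apex.
  refine nonempty_iso_of_bijective (fun x : Fin 2 × Fin 3 =>
    ![![f false 0, f true 0, t], ![f false 1, f true 1, r]] x.1 x.2) ?_ ?_ ?_
  · rintro ⟨x, y⟩ ⟨z, w⟩ he
    fin_cases x <;> fin_cases y <;> fin_cases z <;> fin_cases w <;>
      first
      | rfl
      | (exfalso; simp [hinj, htn0, htn1, hrn0, hrn1, (htn0 _).symm, (htn1 _).symm, (hrn0 _).symm,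
          (hrn1 _).symm, htr.ne, htr.ne'] at he)
  · intro x
    by_cases hx : OffLadder 2 f x
    · rcases hall x hx with rfl | rfl
      · exact ⟨(0, 2), rfl⟩
      · exact ⟨(1, 2), rfl⟩
    · obtain ⟨s, i, hi, rfl⟩ := OffLadder.not_iff.1 hx
      have : i = 0 ∨ i = 1 := by omega
      rcases this with rfl | rfl <;> cases s
      · exact ⟨(0, 0), rfl⟩
      · exact ⟨(0, 1), rfl⟩
      · exact ⟨(1, 0), rfl⟩
      · exact ⟨(1, 1), rfl⟩
  · rintro ⟨x, y⟩ ⟨z, w⟩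
    fin_cases x <;> fin_cases y <;> fin_cases z <;> fin_cases w <;>
      simp [boxProd_adj, pathGraph_adj, h.adj, *, htr.symm]

/-- Each end rung has at most one apex, as a corner has a single free place, and by
`adj_of_adj_apex` an apex has no further neighbour except possibly the apex of the other end. Zero,
one, two non-adjacent or two adjacent apexes give `ladder`, `ladderOne`, `ladderTwo` and the prism.
-/
theorem IsLadder.isPiece_of_endAttached [Finite V] (h : IsLadder G k f) (hconn : G.Connected)
    (hch : IsChordal 4 G) (hbr : Bridgeless G) (hsub : Subcubic G) (hk : 2 ≤ k)
    (he : EndAttached G k f) : IsPiece G := by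
  have hne : f false 0 ∈ {x | ¬ OffLadder k f x} := fun hx => hx false 0 (by omega) rfl
  -- the case of an outer vertex at the first rung only
  have one : ∀ f, IsLadder G k f → EndAttached G k f → ∀ t, OffLadder k f t →
      (∀ s i, i < k → (G.Adj t (f s i) ↔ i = 0)) →
      (∀ r, OffLadder k f r → ∀ s, ¬ G.Adj r (f s (k - 1))) → IsPiece G := by
    intro f h he t ht hta hno
    have hall : {x | OffLadder k f x → x = t} = Set.univ := by
      refine eq_univ_of_closed hconn ⟨t, fun _ => rfl⟩ fun x hx y hxy hy => ?_
      by_cases hxo : OffLadder k f x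
      · obtain rfl := hx hxo
        obtain ⟨rfl, s, hs⟩ := h.adj_of_adj_apex hch hbr hsub hk ht hta hy hxy
        exact (hno y hy s hs).elim
      · obtain ⟨s, i, hi, rfl⟩ := OffLadder.not_iff.1 hxo
        rcases he y hy s i hi hxy.symm with h1 | h1
        · obtain rfl := (h1 s i hi).1 hxy.symm
          rcases h.eq_of_adj_first hsub hk ht ((hta s 0 hi).2 rfl).symm hxy with h2 | h2 | h2
          · exact h2
          · exact (hy _ _ (by omega) h2).elim
          · exact (hy _ _ (by omega) h2).elim
        · exact (hno y hy s ((h1 s _ (by omega)).2 rfl)).elim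
    have hall' : ∀ x, OffLadder k f x → x = t := fun x => Set.eq_univ_iff_forall.1 hall x
    exact Or.inl (Or.inr (Or.inr (Or.inl ⟨h.numDegTwo_ladderOne hk ht hta hall',
      Or.inr (Or.inr ⟨k, hk, h.nonempty_iso_ladderOne ht hta hall'⟩)⟩)))
  by_cases h0 : ∃ t, OffLadder k f t ∧ ∃ s, G.Adj t (f s 0)
  · obtain ⟨t, ht, s, hts⟩ := h0
    have hta : ∀ s i, i < k → (G.Adj t (f s i) ↔ i = 0) := by
      rcases he t ht s 0 (by omega) hts with h1 | h1
      · exact h1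
      · have := (h1 s 0 (by omega)).1 hts; omega
    by_cases h1 : ∃ r, OffLadder k f r ∧ ∃ s, G.Adj r (f s (k - 1))
    · obtain ⟨r, hr, s', hrs⟩ := h1
      have hra : ∀ s i, i < k → (G.Adj r (f s i) ↔ i = k - 1) := by
        rcases he r hr s' (k - 1) (by omega) hrs with h1 | h1
        · have := (h1 s' (k - 1) (by omega)).1 hrs; omega
        · exact h1
      have hra' : ∀ s i, i < k → (G.Adj r (f s (k - 1 - i)) ↔ i = 0) := by
        intro s i hi
        rw [hra s _ (by omega)]; omega
      have hatt : ∀ y, OffLadder k f y → ∀ s i, i < k → G.Adj y (f s i) → y = t ∨ y = r := by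
        intro y hy s i hi hyx
        rcases he y hy s i hi hyx with h1 | h1
        · obtain rfl := (h1 s i hi).1 hyx
          rcases h.eq_of_adj_first hsub hk ht ((hta s 0 hi).2 rfl).symm hyx.symm with
            h2 | h2 | h2
          · exact Or.inl h2
          · exact (hy _ _ (by omega) h2).elim
          · exact (hy _ _ (by omega) h2).elim
        · obtain rfl := (h1 s i hi).1 hyx
          rcases h.flip.eq_of_adj_first hsub hk hr.flip ((hra' s 0 (by omega)).2 rfl).symm
            hyx.symm with h2 | h2 | h2
          · exact Or.inr h2
          · exact (hy _ _ (by omega) h2).elim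
          · exact (hy _ _ (by omega) h2).elim
      have hne : t ≠ r := by
        rintro rfl
        have := (hra s 0 (by omega)).1 hts
        omega
      have hleave : ∀ y, OffLadder k f y → G.Adj t y → y = r := by
        intro y hy hty
        obtain ⟨rfl, s, hs⟩ := h.adj_of_adj_apex hch hbr hsub hk ht hta hy hty
        rcases hatt y hy s 1 (by omega) hs with h2 | h2
        · exact (hty.ne h2.symm).elim
        · exact h2
      have hleave' : ∀ y, OffLadder k f y → G.Adj r y → y = t := by
        intro y hy hty
        obtain ⟨rfl, s, hs⟩ := h.flip.adj_of_adj_apex hch hbr hsub hk hr.flip hra' hy.flip hty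
        rcases hatt y hy s 0 (by omega) hs with h2 | h2
        · exact h2
        · exact (hty.ne h2.symm).elim
      have hall : {x | OffLadder k f x → x = t ∨ x = r} = Set.univ := by
        refine eq_univ_of_closed hconn ⟨t, fun _ => Or.inl rfl⟩ fun x hx y hxy hy => ?_
        by_cases hxo : OffLadder k f x
        · rcases hx hxo with rfl | rfl
          · exact Or.inr (hleave y hy hxy)
          · exact Or.inl (hleave' y hy hxy)
        · obtain ⟨s, i, hi, rfl⟩ := OffLadder.not_iff.1 hxo
          exact hatt y hy s i hi hxy.symm
      have hall' : ∀ x, OffLadder k f x → x = t ∨ x = r :=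
        fun x => Set.eq_univ_iff_forall.1 hall x
      by_cases htr : G.Adj t r
      · obtain ⟨rfl, -⟩ := h.adj_of_adj_apex hch hbr hsub hk ht hta hr htr
        exact Or.inr (Or.inr (Or.inr (h.nonempty_iso_prism ht hta hr hra htr hall')))
      · exact Or.inl (Or.inr (Or.inl ⟨h.numDegTwo_ladderTwo hk ht hta hr hra hne htr hall',
          Or.inr (Or.inr ⟨k, hk, h.nonempty_iso_ladderTwo ht hta hr hra hne htr hall'⟩)⟩))
    · exact one f h he t ht hta fun r hr s hs => h1 ⟨r, hr, s, hs⟩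
  · by_cases h1 : ∃ r, OffLadder k f r ∧ ∃ s, G.Adj r (f s (k - 1))
    · obtain ⟨r, hr, s, hrs⟩ := h1
      have hra : ∀ s i, i < k → (G.Adj r (f s i) ↔ i = k - 1) := by
        rcases he r hr s (k - 1) (by omega) hrs with h1 | h1
        · have := (h1 s (k - 1) (by omega)).1 hrs; omega
        · exact h1
      refine one _ h.flip he.flip r hr.flip (fun s i hi => ?_) fun p hp s hs => ?_
      · rw [hra s _ (by omega)]; omega
      · exact h0 ⟨p, hp.of_flip, s, by simpa using hs⟩
    · have hall : {x | ¬ OffLadder k f x} = Set.univ := by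
        refine eq_univ_of_closed hconn ⟨_, hne⟩ fun x hx y hxy hy => ?_
        obtain ⟨s, i, hi, rfl⟩ := OffLadder.not_iff.1 hx
        rcases he y hy s i hi hxy.symm with h2 | h2
        · exact h0 ⟨y, hy, s, (h2 s 0 (by omega)).2 rfl⟩
        · exact h1 ⟨y, hy, s, (h2 s _ (by omega)).2 rfl⟩
      have hall' : ∀ x, ¬ OffLadder k f x := fun x => Set.eq_univ_iff_forall.1 hall x
      exact Or.inl (Or.inr (Or.inr (Or.inr ⟨h.numDegTwo_ladder hk hall', k, hk,
        h.nonempty_iso_ladder hall'⟩)))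

end LongLadders

/-! ### The sporadic small graphs. -/

section SmallPieces

variable {V : Type u} {G : SimpleGraph V}

theorem numDegTwo_congr {U : Type} {L : SimpleGraph U} (e : G ≃g L) :
    numDegTwo G = numDegTwo L := by
  have hdeg : ∀ x, (L.neighborSet (e x)).ncard = (G.neighborSet x).ncard := by
    intro x
    have : L.neighborSet (e x) = e '' G.neighborSet x := by
      ext y
      obtain ⟨z, rfl⟩ := e.surjective y
      simp [e.map_adj_iff]
    rw [this, Set.ncard_image_of_injective _ e.injective]
  have : {x | (L.neighborSet x).ncard = 2} = e '' {x | (G.neighborSet x).ncard = 2} := by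
    ext y
    obtain ⟨z, rfl⟩ := e.surjective y
    simp [hdeg]
  rw [numDegTwo, numDegTwo, this, Set.ncard_image_of_injective _ e.injective]

/-- Makes the count decidable, so that it can be evaluated on each concrete graph. -/
theorem numDegTwo_eq_card {U : Type} [Fintype U] (L : SimpleGraph U) [DecidableRel L.Adj] :
    numDegTwo L = (Finset.univ.filter fun x => L.degree x = 2).card := by
  have : {x | (L.neighborSet x).ncard = 2} =
      (Finset.univ.filter fun x => L.degree x = 2 : Finset U) := by
    ext x
    simp [← card_neighborSet_eq_degree, Set.ncard_eq_toFinset_card']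
  rw [numDegTwo, this, Set.ncard_coe_finset]

instance addVertex.decidableRel {U : Type} (H : SimpleGraph U) [DecidableRel H.Adj] (S : Set U)
    [DecidablePred (· ∈ S)] : DecidableRel (addVertex H S).Adj
  | some x, some y => inferInstanceAs (Decidable (H.Adj x y))
  | some x, none => inferInstanceAs (Decidable (x ∈ S))
  | none, some y => inferInstanceAs (Decidable (y ∈ S))
  | none, none => inferInstanceAs (Decidable False)

instance diamond.decidableRel : DecidableRel diamond.Adj :=
  fun x y => decidable_of_iff (x ≠ y ∧ ¬ s(x, y) = s(0, 1)) (by simp [diamond])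

instance kThreeThreeMinus.decidableRel : DecidableRel kThreeThreeMinus.Adj :=
  fun x y => decidable_of_iff (x.isLeft ≠ y.isLeft ∧ ¬ s(x, y) = s(Sum.inl 0, Sum.inr 0)) (by
    rcases x with x | x <;> rcases y with y | y <;> simp [kThreeThreeMinus])

instance diamondPlus.decidableRel : DecidableRel diamondPlus.Adj :=
  inferInstanceAs (DecidableRel (addVertex diamond ({0, 1} : Set (Fin 4))).Adj)

theorem numDegTwo_completeGraph_three : numDegTwo (completeGraph (Fin 3)) = 3 := by
  let _ : DecidableRel (completeBipartiteGraph (Fin 2) (Fin 3)).Adj :=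
    fun x y => decidable_of_iff (x.isLeft ≠ y.isLeft) (by
      rcases x with x | x <;> rcases y with y | y <;> simp)
  rw [numDegTwo_eq_card]; decide

theorem numDegTwo_diamond : numDegTwo diamond = 2 := by
  rw [numDegTwo_eq_card]; decide

theorem numDegTwo_diamondPlus : numDegTwo diamondPlus = 1 := by
  rw [numDegTwo_eq_card]; decide

theorem numDegTwo_kThreeThreeMinus : numDegTwo kThreeThreeMinus = 2 := by
  rw [numDegTwo_eq_card]; decide

theorem numDegTwo_completeBipartiteGraph :
    numDegTwo (completeBipartiteGraph (Fin 2) (Fin 3)) = 3 := by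
  let _ : DecidableRel (completeBipartiteGraph (Fin 2) (Fin 3)).Adj :=
    fun x y => decidable_of_iff (x.isLeft ≠ y.isLeft) (by
      rcases x with x | x <;> rcases y with y | y <;> simp)
  rw [numDegTwo_eq_card]; decide

theorem isPiece_of_triangle_univ {a b c : V} (hab : G.Adj a b) (hbc : G.Adj b c)
    (hca : G.Adj c a) (hall : ∀ x, x = a ∨ x = b ∨ x = c) : IsPiece G := by
  have e : Nonempty (G ≃g completeGraph (Fin 3)) := by
    have := hab.ne; have := hbc.ne; have := hca.ne
    have := hab.ne'; have := hbc.ne'; have := hca.ne'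
    refine nonempty_iso_of_bijective ![a, b, c] ?_ ?_ ?_
    · intro x y he
      fin_cases x <;> fin_cases y <;> simp_all
    · intro x
      rcases hall x with rfl | rfl | rfl
      · exact ⟨0, rfl⟩
      · exact ⟨1, rfl⟩
      · exact ⟨2, rfl⟩
    · intro x y
      fin_cases x <;> fin_cases y <;> simp [*, hab.symm, hbc.symm, hca.symm]
  exact Or.inl (Or.inr (Or.inr (Or.inl
    ⟨(numDegTwo_congr e.some).trans numDegTwo_completeGraph_three, Or.inl e⟩)))

theorem nonempty_iso_completeGraph_four {a b c p : V} (hab : G.Adj a b) (hbc : G.Adj b c)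
    (hca : G.Adj c a) (hpa : G.Adj p a) (hpb : G.Adj p b) (hpc : G.Adj p c)
    (hall : ∀ x, x = a ∨ x = b ∨ x = c ∨ x = p) : Nonempty (G ≃g completeGraph (Fin 4)) := by
  have := hab.ne; have := hbc.ne; have := hca.ne; have := hpa.ne; have := hpb.ne; have := hpc.ne
  have := hab.ne'; have := hbc.ne'; have := hca.ne'
  have := hpa.ne'; have := hpb.ne'; have := hpc.ne'
  refine nonempty_iso_of_bijective ![a, b, c, p] ?_ ?_ ?_
  · intro x y he
    fin_cases x <;> fin_cases y <;> simp_all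
  · intro x
    rcases hall x with rfl | rfl | rfl | rfl
    · exact ⟨0, rfl⟩
    · exact ⟨1, rfl⟩
    · exact ⟨2, rfl⟩
    · exact ⟨3, rfl⟩
  · intro x y
    fin_cases x <;> fin_cases y <;>
      simp [*, hab.symm, hbc.symm, hca.symm, hpa.symm, hpb.symm, hpc.symm]

theorem nonempty_iso_diamond {a b c p : V} (hab : G.Adj a b) (hbc : G.Adj b c)
    (hca : G.Adj c a) (hpa : G.Adj p a) (hpb : G.Adj p b) (hpc : p ≠ c) (npc : ¬ G.Adj p c)
    (hall : ∀ x, x = a ∨ x = b ∨ x = c ∨ x = p) : Nonempty (G ≃g diamond) := by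
  have := hab.ne; have := hbc.ne; have := hca.ne; have := hpa.ne; have := hpb.ne
  have := hab.ne'; have := hbc.ne'; have := hca.ne'
  have := hpa.ne'; have := hpb.ne'; have := hpc.symm
  have ncp : ¬ G.Adj c p := fun h => npc h.symm
  -- The non-adjacent pair comes first, because `diamond` lacks the edge `01`.
  refine nonempty_iso_of_bijective ![c, p, a, b] ?_ ?_ ?_
  · intro x y he
    fin_cases x <;> fin_cases y <;> simp_all
  · intro x
    rcases hall x with rfl | rfl | rfl | rfl
    · exact ⟨2, rfl⟩
    · exact ⟨3, rfl⟩
    · exact ⟨0, rfl⟩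
    · exact ⟨1, rfl⟩
  · intro x y
    fin_cases x <;> fin_cases y <;>
      simp [*, hab.symm, hbc.symm, hca.symm, hpa.symm, hpb.symm, diamond]

/-- `a b c d` is an induced cycle of length four. -/
structure IsFourCycle (G : SimpleGraph V) (a b c d : V) : Prop where
  ab : G.Adj a b
  bc : G.Adj b c
  cd : G.Adj c d
  da : G.Adj d a
  hac : a ≠ c
  hbd : b ≠ d
  nac : ¬ G.Adj a c
  nbd : ¬ G.Adj b d

theorem IsFourCycle.rotate {a b c d : V} (h : IsFourCycle G a b c d) : IsFourCycle G b c d a :=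
  ⟨h.bc, h.cd, h.da, h.ab, h.hbd, h.hac.symm, h.nbd, fun h' => h.nac h'.symm⟩

theorem IsFourCycle.reflect {a b c d : V} (h : IsFourCycle G a b c d) : IsFourCycle G a d c b :=
  ⟨h.da.symm, h.cd.symm, h.bc.symm, h.ab.symm, h.hac, h.hbd.symm, h.nac, fun h' => h.nbd h'.symm⟩

theorem IsFourCycle.nonempty_iso_diamondPlus {a b c d p : V} (h : IsFourCycle G a b c d)
    (hpa : G.Adj p a) (hpb : G.Adj p b) (hpc : G.Adj p c) (hpd : p ≠ d) (npd : ¬ G.Adj p d)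
    (hall : ∀ x, x = a ∨ x = b ∨ x = c ∨ x = d ∨ x = p) : Nonempty (G ≃g diamondPlus) := by
  obtain ⟨hab, hbc, hcd, hda, hac, hbd, nac, nbd⟩ := h
  have := hab.ne; have := hbc.ne; have := hcd.ne; have := hda.ne
  have := hpa.ne; have := hpb.ne; have := hpc.ne
  have := hab.ne'; have := hbc.ne'; have := hcd.ne'; have := hda.ne'
  have := hpa.ne'; have := hpb.ne'; have := hpc.ne'
  have := hac.symm; have := hbd.symm; have := hpd.symm
  have nca : ¬ G.Adj c a := fun h => nac h.symm
  have ndb : ¬ G.Adj d b := fun h => nbd h.symm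
  have ndp : ¬ G.Adj d p := fun h => npd h.symm
  -- The diamond is on `a, c, b, p` with `ac` missing, and `d` is the vertex added to it.
  refine nonempty_iso_of_bijective (fun x : Option (Fin 4) => x.elim d ![a, c, b, p]) ?_ ?_ ?_
  · rintro (_ | x) (_ | y) he
    · rfl
    · fin_cases y <;> simp_all
    · fin_cases x <;> simp_all
    · fin_cases x <;> fin_cases y <;> simp_all
  · intro x
    rcases hall x with rfl | rfl | rfl | rfl | rfl
    · exact ⟨some 0, rfl⟩
    · exact ⟨some 2, rfl⟩
    · exact ⟨some 1, rfl⟩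
    · exact ⟨none, rfl⟩
    · exact ⟨some 3, rfl⟩
  · rintro (_ | x) (_ | y)
    · exact iff_of_false (G.irrefl) id
    · fin_cases y <;> simp [*, hcd.symm, diamondPlus, addVertex]
    · fin_cases x <;> simp [*, hda.symm, diamondPlus, addVertex]
    · fin_cases x <;> fin_cases y <;>
        simp [*, hab.symm, hbc.symm, hpa.symm, hpb.symm, hpc.symm, diamondPlus, addVertex, diamond]

theorem nonempty_iso_completeBipartiteGraph {m n : ℕ} {x : Fin m → V} {y : Fin n → V}
    (hx : Function.Injective x) (hy : Function.Injective y)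
    (nx : ∀ i j, ¬ G.Adj (x i) (x j)) (ny : ∀ i j, ¬ G.Adj (y i) (y j))
    (hxy : ∀ i j, G.Adj (x i) (y j)) (hall : ∀ z, (∃ i, z = x i) ∨ ∃ j, z = y j) :
    Nonempty (G ≃g completeBipartiteGraph (Fin m) (Fin n)) := by
  refine nonempty_iso_of_bijective (Sum.elim x y) ?_ ?_ ?_
  · exact hx.sumElim hy fun i j => (hxy i j).ne
  · intro z
    rcases hall z with ⟨i, rfl⟩ | ⟨j, rfl⟩
    · exact ⟨Sum.inl i, rfl⟩
    · exact ⟨Sum.inr j, rfl⟩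
  · rintro (i | i) (j | j)
    · simp [nx]
    · simp [hxy]
    · simp [(hxy _ _).symm]
    · simp [ny]

theorem nonempty_iso_kThreeThreeMinus {x y : Fin 3 → V}
    (hx : Function.Injective x) (hy : Function.Injective y)
    (nx : ∀ i j, ¬ G.Adj (x i) (x j)) (ny : ∀ i j, ¬ G.Adj (y i) (y j))
    (hxy : ∀ i j, G.Adj (x i) (y j) ↔ ¬ (i = 0 ∧ j = 0)) (h0 : x 0 ≠ y 0)
    (hall : ∀ z, (∃ i, z = x i) ∨ ∃ j, z = y j) :
    Nonempty (G ≃g kThreeThreeMinus) := by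
  refine nonempty_iso_of_bijective (Sum.elim x y) ?_ ?_ ?_
  · refine hx.sumElim hy fun i j => ?_
    by_cases h : i = 0 ∧ j = 0
    · rw [h.1, h.2]; exact h0
    · exact ((hxy i j).2 h).ne
  · intro z
    rcases hall z with ⟨i, rfl⟩ | ⟨j, rfl⟩
    · exact ⟨Sum.inl i, rfl⟩
    · exact ⟨Sum.inr j, rfl⟩
  · rintro (i | i) (j | j)
    · simp [nx, kThreeThreeMinus]
    · simp [hxy, kThreeThreeMinus]
    · simp [G.adj_comm (y i), hxy, kThreeThreeMinus, and_comm]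
    · simp [ny, kThreeThreeMinus]

end SmallPieces

/-! ### No induced 4-cycle; and the 4-cycle with a vertex joined to three of its vertices. -/

section NoLongLadder

variable {V : Type u} {G : SimpleGraph V}

/-- If `p` and `c` are adjacent, all four vertices are saturated and `G` is `K₄`. Otherwise a
further neighbour `q` of `c` would lie with `c` on a short cycle running through `a` or `b` and then
`p`, which is an induced 4-cycle; by symmetry `p` has no further neighbour either. -/
theorem isPiece_of_diamond (hconn : G.Connected) (hch : IsChordal 4 G)
    (hbr : Bridgeless G) (hsub : Subcubic G) (h2 : ∀ f, ¬ IsLadder G 2 f) {a b c p : V}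
    (hab : G.Adj a b) (hbc : G.Adj b c) (hca : G.Adj c a) (hpa : G.Adj p a) (hpb : G.Adj p b)
    (hpc : p ≠ c) : IsPiece G := by
  have sa : ∀ x, G.Adj a x → x = b ∨ x = c ∨ x = p := fun x hx =>
    hsub a b c p x hab hca.symm hpa.symm hx hbc.ne hpb.ne' hpc.symm
  have sb : ∀ x, G.Adj b x → x = a ∨ x = c ∨ x = p := fun x hx =>
    hsub b a c p x hab.symm hbc hpb.symm hx hca.ne' hpa.ne' hpc.symm
  by_cases npc : G.Adj p c
  · have sc : ∀ x, G.Adj c x → x = a ∨ x = b ∨ x = p := fun x hx =>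
      hsub c a b p x hca hbc.symm npc.symm hx hab.ne hpa.ne' hpb.ne'
    have sp : ∀ x, G.Adj p x → x = a ∨ x = b ∨ x = c := fun x hx =>
      hsub p a b c x hpa hpb npc hx hab.ne hca.ne' hbc.ne
    have hall : {x | x = a ∨ x = b ∨ x = c ∨ x = p} = Set.univ := by
      refine eq_univ_of_closed hconn ⟨a, Or.inl rfl⟩ ?_
      rintro x (rfl | rfl | rfl | rfl) y hy
      · rcases sa y hy with rfl | rfl | rfl <;> simp
      · rcases sb y hy with rfl | rfl | rfl <;> simp
      · rcases sc y hy with rfl | rfl | rfl <;> simp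
      · rcases sp y hy with rfl | rfl | rfl <;> simp
    exact Or.inr (Or.inl (nonempty_iso_completeGraph_four hab hbc hca hpa hpb npc
      (Set.eq_univ_iff_forall.1 hall)))
  · have key : ∀ c p, G.Adj b c → G.Adj c a → G.Adj p a → G.Adj p b → p ≠ c → ¬ G.Adj p c →
        ∀ q, G.Adj c q → q = a ∨ q = b := by
      intro c p hbc hca hpa hpb hpc npc q hq
      by_contra! hcon
      have hqp : q ≠ p := fun h => npc (h ▸ hq.symm)
      have sa : ∀ x, G.Adj a x → x = b ∨ x = c ∨ x = p := fun x hx =>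
        hsub a b c p x hab hca.symm hpa.symm hx hbc.ne hpb.ne' hpc.symm
      have sb : ∀ x, G.Adj b x → x = a ∨ x = c ∨ x = p := fun x hx =>
        hsub b a c p x hab.symm hbc hpb.symm hx hca.ne' hpa.ne' hpc.symm
      have sc : ∀ x, G.Adj c x → x = a ∨ x = b ∨ x = q := fun x hx =>
        hsub c a b q x hca hbc.symm hq hx hab.ne hcon.1.symm hcon.2.symm
      have na : ¬ G.Adj a q := fun h => by
        rcases sa q h with h | h | h
        · exact hcon.2 h
        · exact hq.ne h.symm
        · exact hqp h
      have nb : ¬ G.Adj b q := fun h => by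
        rcases sb q h with h | h | h
        · exact hcon.1 h
        · exact hq.ne h.symm
        · exact hqp h
      rcases hch.exists_short_cycle hq (hbr _ _ hq) with
        ⟨z, hz1, hz2⟩ | ⟨z, w, h3, h4, h5, h6, h7⟩
      · rcases sc z hz1 with rfl | rfl | rfl
        · exact na hz2
        · exact nb hz2
        · exact hz2.ne rfl
      · rcases sc z h3 with rfl | rfl | rfl
        · rcases sa w h4 with rfl | rfl | rfl
          · exact nb h5
          · exact h7 rfl
          · exact h2 _ (isLadder_two hca.symm hq h5.symm hpa hcon.1.symm hpc.symm na
              (fun h => npc h.symm))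
        · rcases sb w h4 with rfl | rfl | rfl
          · exact na h5
          · exact h7 rfl
          · exact h2 _ (isLadder_two hbc hq h5.symm hpb hcon.2.symm hpc.symm nb
              (fun h => npc h.symm))
        · exact h6 rfl
    have hall : {x | x = a ∨ x = b ∨ x = c ∨ x = p} = Set.univ := by
      refine eq_univ_of_closed hconn ⟨a, Or.inl rfl⟩ ?_
      rintro x (rfl | rfl | rfl | rfl) y hy
      · rcases sa y hy with rfl | rfl | rfl <;> simp
      · rcases sb y hy with rfl | rfl | rfl <;> simp
      · rcases key _ _ hbc hca hpa hpb hpc npc y hy with rfl | rfl <;> simp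
      · rcases key _ _ hpb.symm hpa hca hbc.symm hpc.symm (fun h => npc h.symm) y hy with
          rfl | rfl <;> simp
    have e := nonempty_iso_diamond hab hbc hca hpa hpb hpc npc (Set.eq_univ_iff_forall.1 hall)
    exact Or.inl (Or.inr (Or.inl ⟨(numDegTwo_congr e.some).trans numDegTwo_diamond, Or.inl e⟩))

/-- Without induced 4-cycles, a 4-cycle through the edge has a chord, which cuts off a triangle on
the edge. -/
theorem exists_triangle (hch : IsChordal 4 G) (hbr : Bridgeless G)
    (h2 : ∀ f, ¬ IsLadder G 2 f) {a b : V} (hab : G.Adj a b) : ∃ z, G.Adj a z ∧ G.Adj z b := by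
  rcases hch.exists_short_cycle hab (hbr _ _ hab) with h | ⟨z, w, h3, h4, h5, h6, h7⟩
  · exact h
  · by_cases h8 : G.Adj a w
    · exact ⟨w, h8, h5⟩
    by_cases h9 : G.Adj z b
    · exact ⟨z, h3, h9⟩
    exact (h2 _ (isLadder_two h3 h4 h5 hab.symm h7.symm h6 h8 h9)).elim

/-- An edge leaving a triangle at `a` lies in a triangle itself; as `a` has degree at most 3, the
two triangles share an edge and form a diamond. If no edge leaves, the triangle is all of `G`. -/
theorem isPiece_of_no_ladder_two (hconn : G.Connected) (hch : IsChordal 4 G)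
    (hbr : Bridgeless G) (hsub : Subcubic G) (h2 : ∀ f, ¬ IsLadder G 2 f) {a b : V}
    (hab : G.Adj a b) : IsPiece G := by
  obtain ⟨c, hac, hcb⟩ := exists_triangle hch hbr h2 hab
  have key : ∀ a b c, G.Adj a b → G.Adj b c → G.Adj c a → ∀ p, p ≠ b → p ≠ c → G.Adj a p →
      IsPiece G := by
    intro a b c hab hbc hca p hpb hpc hap
    obtain ⟨z, hz1, hz2⟩ := exists_triangle hch hbr h2 hap
    rcases hsub a b c p z hab hca.symm hap hz1 hbc.ne hpb.symm hpc.symm with rfl | rfl | rfl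
    · exact isPiece_of_diamond hconn hch hbr hsub h2 hab hbc hca hap.symm hz2.symm hpc
    · exact isPiece_of_diamond hconn hch hbr hsub h2 hca.symm hbc.symm hab.symm hap.symm
        hz2.symm hpb
    · exact (hz2.ne rfl).elim
  by_contra hcon
  refine hcon (isPiece_of_triangle_univ hab hcb.symm hac.symm fun x => ?_)
  revert x
  refine Set.eq_univ_iff_forall.1 (eq_univ_of_closed (S := {x | x = a ∨ x = b ∨ x = c}) hconn
    ⟨a, Or.inl rfl⟩ ?_)
  rintro x (rfl | rfl | rfl) y hy <;> by_contra hyS <;>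
    simp only [Set.mem_ofPred_eq, not_or] at hyS
  · exact hcon (key _ _ _ hab hcb.symm hac.symm y hyS.2.1 hyS.2.2 hy)
  · exact hcon (key _ _ _ hcb.symm hac.symm hab y hyS.2.2 hyS.1 hy)
  · exact hcon (key _ _ _ hac.symm hab hcb.symm y hyS.1 hyS.2.1 hy)

/-- The vertices `a, b, c, p` are saturated. A further neighbour `q` of `d` would need a short cycle
through `dq`, which enters the saturated set at `a` or `c` and cannot get from there to `q`. -/
theorem IsFourCycle.isPiece_of_diamondPlus {a b c d p : V} (h : IsFourCycle G a b c d)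
    (hconn : G.Connected) (hch : IsChordal 4 G) (hbr : Bridgeless G) (hsub : Subcubic G)
    (hpa : G.Adj p a) (hpb : G.Adj p b) (hpc : G.Adj p c) (hpd : p ≠ d) : IsPiece G := by
  have ⟨hab, hbc, hcd, hda, hac, hbd, nac, nbd⟩ := h
  have sa : ∀ x, G.Adj a x → x = b ∨ x = d ∨ x = p := fun x hx =>
    hsub a b d p x hab hda.symm hpa.symm hx hbd hpb.ne' hpd.symm
  have sc : ∀ x, G.Adj c x → x = b ∨ x = d ∨ x = p := fun x hx =>
    hsub c b d p x hbc.symm hcd hpc.symm hx hbd hpb.ne' hpd.symm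
  have sb : ∀ x, G.Adj b x → x = a ∨ x = c ∨ x = p := fun x hx =>
    hsub b a c p x hab.symm hbc hpb.symm hx hac hpa.ne' hpc.ne'
  have sp : ∀ x, G.Adj p x → x = a ∨ x = b ∨ x = c := fun x hx =>
    hsub p a b c x hpa hpb hpc hx hab.ne hac hbc.ne
  have sd : ∀ q, G.Adj d q → q = a ∨ q = c := by
    intro q hq
    by_contra! hcon
    have sd : ∀ x, G.Adj d x → x = a ∨ x = c ∨ x = q := fun x hx =>
      hsub d a c q x hda hcd.symm hq hx hac hcon.1.symm hcon.2.symm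
    have nb : ¬ G.Adj b q := fun hbq => by
      rcases sb q hbq with rfl | rfl | rfl
      · exact hcon.1 rfl
      · exact hcon.2 rfl
      · rcases sp d hq.symm with rfl | rfl | rfl
        · exact hda.ne rfl
        · exact hbd rfl
        · exact hcd.ne rfl
    have np : ¬ G.Adj p q := fun hpq => by
      rcases sp q hpq with rfl | rfl | rfl
      · exact hcon.1 rfl
      · exact nbd hq.symm
      · exact hcon.2 rfl
    have na : ¬ G.Adj a q := fun h => by
      rcases sa q h with rfl | rfl | rfl
      · exact nbd hq.symm
      · exact hq.ne rfl
      · exact nb hpb.symm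
    have nc : ¬ G.Adj c q := fun h => by
      rcases sc q h with rfl | rfl | rfl
      · exact nbd hq.symm
      · exact hq.ne rfl
      · exact nb hpb.symm
    rcases hch.exists_short_cycle hq (hbr _ _ hq) with
      ⟨z, hz1, hz2⟩ | ⟨z, w, h3, h4, h5, h6, h7⟩
    · rcases sd z hz1 with rfl | rfl | rfl
      · exact na hz2
      · exact nc hz2
      · exact hz2.ne rfl
    · rcases sd z h3 with rfl | rfl | rfl
      · rcases sa w h4 with rfl | rfl | rfl
        · exact nb h5
        · exact h7 rfl
        · exact np h5
      · rcases sc w h4 with rfl | rfl | rfl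
        · exact nb h5
        · exact h7 rfl
        · exact np h5
      · exact h6 rfl
  have hall : {x | x = a ∨ x = b ∨ x = c ∨ x = d ∨ x = p} = Set.univ := by
    refine eq_univ_of_closed hconn ⟨a, Or.inl rfl⟩ ?_
    rintro x (rfl | rfl | rfl | rfl | rfl) y hy
    · rcases sa y hy with rfl | rfl | rfl <;> simp
    · rcases sb y hy with rfl | rfl | rfl <;> simp
    · rcases sc y hy with rfl | rfl | rfl <;> simp
    · rcases sd y hy with rfl | rfl <;> simp
    · rcases sp y hy with rfl | rfl | rfl <;> simp
  have npd : ¬ G.Adj p d := fun h' => by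
    rcases sp d h' with rfl | rfl | rfl
    · exact hda.ne rfl
    · exact hbd rfl
    · exact hcd.ne rfl
  have e := h.nonempty_iso_diamondPlus hpa hpb hpc hpd npd (Set.eq_univ_iff_forall.1 hall)
  exact Or.inl (Or.inl ⟨(numDegTwo_congr e.some).trans numDegTwo_diamondPlus, e⟩)

end NoLongLadder

/-! ### Induced 4-cycles without a third rung, and the classification of bridgeless pieces. -/

section FourCycles

variable {V : Type u} {G : SimpleGraph V}

/-- The vertices `b`, `d`, `p` are distinct, pairwise non-adjacent, and are all joined to the
non-adjacent vertices `a` and `c`. -/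
structure IsTwoThree (G : SimpleGraph V) (a c b d p : V) : Prop where
  ab : G.Adj a b
  ad : G.Adj a d
  ap : G.Adj a p
  cb : G.Adj c b
  cd : G.Adj c d
  cp : G.Adj c p
  hac : a ≠ c
  hbd : b ≠ d
  hbp : b ≠ p
  hdp : d ≠ p
  nac : ¬ G.Adj a c
  nbd : ¬ G.Adj b d
  nbp : ¬ G.Adj b p
  ndp : ¬ G.Adj d p

variable {a b c d p q : V}

theorem IsTwoThree.rotate (h : IsTwoThree G a c b d p) : IsTwoThree G a c d p b :=
  ⟨h.ad, h.ap, h.ab, h.cd, h.cp, h.cb, h.hac, h.hdp, h.hbd.symm, h.hbp.symm, h.nac, h.ndp,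
    fun h' => h.nbd h'.symm, fun h' => h.nbp h'.symm⟩

theorem IsTwoThree.swap (h : IsTwoThree G a c b d p) : IsTwoThree G c a b d p :=
  ⟨h.cb, h.cd, h.cp, h.ab, h.ad, h.ap, h.hac.symm, h.hbd, h.hbp, h.hdp,
    fun h' => h.nac h'.symm, h.nbd, h.nbp, h.ndp⟩

theorem IsTwoThree.eq_of_adj (h : IsTwoThree G a c b d p) (hsub : Subcubic G) (x : V)
    (hx : G.Adj a x) : x = b ∨ x = d ∨ x = p :=
  hsub a b d p x h.ab h.ad h.ap hx h.hbd h.hbp h.hdp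

/-- The short cycle through `bq` goes from `b` to `a` or `c`, whose only other neighbours are `d`
and `p`, and then to `q`. -/
theorem IsTwoThree.adj_or_adj (h : IsTwoThree G a c b d p) (hch : IsChordal 4 G)
    (hbr : Bridgeless G) (hsub : Subcubic G) (hq : G.Adj b q) (hqa : q ≠ a) (hqc : q ≠ c) :
    G.Adj q d ∨ G.Adj q p := by
  have sb : ∀ x, G.Adj b x → x = a ∨ x = c ∨ x = q := fun x hx =>
    hsub b a c q x h.ab.symm h.cb.symm hq hx h.hac hqa.symm hqc.symm
  have na : ∀ a c, IsTwoThree G a c b d p → ¬ G.Adj a q := fun a c h ha => by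
    rcases h.eq_of_adj hsub q ha with rfl | rfl | rfl
    · exact hq.ne rfl
    · exact h.nbd hq
    · exact h.nbp hq
  have key : ∀ a c w, IsTwoThree G a c b d p → G.Adj a w → G.Adj w q → w ≠ b →
      G.Adj q d ∨ G.Adj q p := by
    intro a c w h haw hwq hwb
    rcases h.eq_of_adj hsub w haw with rfl | rfl | rfl
    · exact (hwb rfl).elim
    · exact Or.inl hwq.symm
    · exact Or.inr hwq.symm
  rcases hch.exists_short_cycle hq (hbr _ _ hq) with
    ⟨z, hz1, hz2⟩ | ⟨z, w, h3, h4, h5, h6, h7⟩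
  · rcases sb z hz1 with rfl | rfl | rfl
    · exact (na _ _ h hz2).elim
    · exact (na _ _ h.swap hz2).elim
    · exact (hz2.ne rfl).elim
  · rcases sb z h3 with rfl | rfl | rfl
    · exact key _ _ w h h4 h5 h7
    · exact key _ _ w h.swap h4 h5 h7
    · exact (h6 rfl).elim

theorem IsTwoThree.isPiece_of_kThreeThree (h : IsTwoThree G a c b d p) (hconn : G.Connected)
    (hsub : Subcubic G) (hqb : G.Adj q b) (hqd : G.Adj q d) (hqp : G.Adj q p) (hqa : q ≠ a)
    (hqc : q ≠ c) : IsPiece G := by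
  have sa := h.eq_of_adj hsub
  have sc := h.swap.eq_of_adj hsub
  have sq : ∀ x, G.Adj q x → x = b ∨ x = d ∨ x = p := fun x hx =>
    hsub q b d p x hqb hqd hqp hx h.hbd h.hbp h.hdp
  have sb : ∀ x, G.Adj b x → x = a ∨ x = c ∨ x = q := fun x hx =>
    hsub b a c q x h.ab.symm h.cb.symm hqb.symm hx h.hac hqa.symm hqc.symm
  have sd : ∀ x, G.Adj d x → x = a ∨ x = c ∨ x = q := fun x hx =>
    hsub d a c q x h.ad.symm h.cd.symm hqd.symm hx h.hac hqa.symm hqc.symm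
  have sp : ∀ x, G.Adj p x → x = a ∨ x = c ∨ x = q := fun x hx =>
    hsub p a c q x h.ap.symm h.cp.symm hqp.symm hx h.hac hqa.symm hqc.symm
  have hall : {x | x = a ∨ x = c ∨ x = q ∨ x = b ∨ x = d ∨ x = p} = Set.univ := by
    refine eq_univ_of_closed hconn ⟨a, Or.inl rfl⟩ ?_
    rintro x (rfl | rfl | rfl | rfl | rfl | rfl) y hy
    · rcases sa y hy with rfl | rfl | rfl <;> simp
    · rcases sc y hy with rfl | rfl | rfl <;> simp
    · rcases sq y hy with rfl | rfl | rfl <;> simp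
    · rcases sb y hy with rfl | rfl | rfl <;> simp
    · rcases sd y hy with rfl | rfl | rfl <;> simp
    · rcases sp y hy with rfl | rfl | rfl <;> simp
  obtain ⟨hab, had, hap, hcb, hcd, hcp, hac, hbd, hbp, hdp, nac, nbd, nbp, ndp⟩ := h
  have naq : ¬ G.Adj a q := fun h => by
    rcases sa q h with rfl | rfl | rfl
    · exact hqb.ne rfl
    · exact hqd.ne rfl
    · exact hqp.ne rfl
  have ncq : ¬ G.Adj c q := fun h => by
    rcases sc q h with rfl | rfl | rfl
    · exact hqb.ne rfl
    · exact hqd.ne rfl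
    · exact hqp.ne rfl
  have nca : ¬ G.Adj c a := fun h => nac h.symm
  have nqa : ¬ G.Adj q a := fun h => naq h.symm
  have nqc : ¬ G.Adj q c := fun h => ncq h.symm
  have ndb : ¬ G.Adj d b := fun h => nbd h.symm
  have npb : ¬ G.Adj p b := fun h => nbp h.symm
  have npd : ¬ G.Adj p d := fun h => ndp h.symm
  refine Or.inr (Or.inr (Or.inl (nonempty_iso_completeBipartiteGraph (x := ![a, c, q])
    (y := ![b, d, p]) ?_ ?_ ?_ ?_ ?_ ?_)))
  · have := hac.symm; have := hqa.symm; have := hqc.symm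
    intro i j hij
    fin_cases i <;> fin_cases j <;> simp_all
  · have := hbd.symm; have := hbp.symm; have := hdp.symm
    intro i j hij
    fin_cases i <;> fin_cases j <;> simp_all
  · intro i j
    fin_cases i <;> fin_cases j <;> simp [*]
  · intro i j
    fin_cases i <;> fin_cases j <;> simp [*]
  · intro i j
    fin_cases i <;> fin_cases j <;> simp [*]
  · intro z
    rcases Set.eq_univ_iff_forall.1 hall z with rfl | rfl | rfl | rfl | rfl | rfl
    · exact Or.inl ⟨0, rfl⟩
    · exact Or.inl ⟨1, rfl⟩
    · exact Or.inl ⟨2, rfl⟩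
    · exact Or.inr ⟨0, rfl⟩
    · exact Or.inr ⟨1, rfl⟩
    · exact Or.inr ⟨2, rfl⟩

/-- The vertices `a, b, c, d` are saturated. By `adj_or_adj`, a further neighbour of `p` would be
joined to `b` or `d`, which is impossible. A short cycle through a further edge at `q` would have to
return through `a` or `c`. Hence there are only six vertices. -/
theorem IsTwoThree.isPiece_of_kThreeThreeMinus (h : IsTwoThree G a c b d p) (hconn : G.Connected)
    (hch : IsChordal 4 G) (hbr : Bridgeless G)
    (hsub : Subcubic G) (hqb : G.Adj q b) (hqd : G.Adj q d) (nqp : ¬ G.Adj q p) (hqa : q ≠ a)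
    (hqc : q ≠ c) : IsPiece G := by
  have sa := h.eq_of_adj hsub
  have sc := h.swap.eq_of_adj hsub
  have hqp : q ≠ p := fun h' => h.nbp (h' ▸ hqb.symm)
  have sb : ∀ x, G.Adj b x → x = a ∨ x = c ∨ x = q := fun x hx =>
    hsub b a c q x h.ab.symm h.cb.symm hqb.symm hx h.hac hqa.symm hqc.symm
  have sd : ∀ x, G.Adj d x → x = a ∨ x = c ∨ x = q := fun x hx =>
    hsub d a c q x h.ad.symm h.cd.symm hqd.symm hx h.hac hqa.symm hqc.symm
  have sp : ∀ r, G.Adj p r → r = a ∨ r = c := by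
    intro r hr
    by_contra! hcon
    have hrq : r ≠ q := fun h' => nqp (h' ▸ hr.symm)
    rcases h.rotate.rotate.adj_or_adj hch hbr hsub hr hcon.1 hcon.2 with h1 | h1
    · rcases sb r h1.symm with h2 | h2 | h2
      · exact hcon.1 h2
      · exact hcon.2 h2
      · exact hrq h2
    · rcases sd r h1.symm with h2 | h2 | h2
      · exact hcon.1 h2
      · exact hcon.2 h2
      · exact hrq h2
  have naq : ¬ G.Adj a q := fun h' => by
    rcases sa q h' with rfl | rfl | rfl
    · exact hqb.ne rfl
    · exact hqd.ne rfl
    · exact hqp rfl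
  have ncq : ¬ G.Adj c q := fun h' => by
    rcases sc q h' with rfl | rfl | rfl
    · exact hqb.ne rfl
    · exact hqd.ne rfl
    · exact hqp rfl
  have sq : ∀ r, G.Adj q r → r = b ∨ r = d := by
    intro r hr
    by_contra! hcon
    have hrp : r ≠ p := fun h' => nqp (h' ▸ hr)
    have hra : r ≠ a := fun h' => naq (h' ▸ hr.symm)
    have hrc : r ≠ c := fun h' => ncq (h' ▸ hr.symm)
    have sq : ∀ x, G.Adj q x → x = b ∨ x = d ∨ x = r := fun x hx =>
      hsub q b d r x hqb hqd hr hx h.hbd hcon.1.symm hcon.2.symm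
    have nr : ∀ x, G.Adj x r → x ≠ a ∧ x ≠ b ∧ x ≠ c ∧ x ≠ d := by
      intro x hx
      refine ⟨?_, ?_, ?_, ?_⟩ <;> rintro rfl
      · rcases sa r hx with h1 | h1 | h1
        · exact hcon.1 h1
        · exact hcon.2 h1
        · exact hrp h1
      · rcases sb r hx with h1 | h1 | h1
        · exact hra h1
        · exact hrc h1
        · exact hr.ne h1.symm
      · rcases sc r hx with h1 | h1 | h1
        · exact hcon.1 h1
        · exact hcon.2 h1
        · exact hrp h1
      · rcases sd r hx with h1 | h1 | h1
        · exact hra h1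
        · exact hrc h1
        · exact hr.ne h1.symm
    rcases hch.exists_short_cycle hr (hbr _ _ hr) with
      ⟨z, hz1, hz2⟩ | ⟨z, w, h3, h4, h5, h6, h7⟩
    · have := nr z hz2
      rcases sq z hz1 with h1 | h1 | rfl
      · exact this.2.1 h1
      · exact this.2.2.2 h1
      · exact hz2.ne rfl
    · have := nr w h5
      rcases sq z h3 with rfl | rfl | rfl
      · rcases sb w h4 with h1 | h1 | h1
        · exact this.1 h1
        · exact this.2.2.1 h1
        · exact h7 h1
      · rcases sd w h4 with h1 | h1 | h1
        · exact this.1 h1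
        · exact this.2.2.1 h1
        · exact h7 h1
      · exact h6 rfl
  have hall : {x | x = q ∨ x = a ∨ x = c ∨ x = p ∨ x = b ∨ x = d} = Set.univ := by
    refine eq_univ_of_closed hconn ⟨q, Or.inl rfl⟩ ?_
    rintro x (rfl | rfl | rfl | rfl | rfl | rfl) y hy
    · rcases sq y hy with rfl | rfl <;> simp
    · rcases sa y hy with rfl | rfl | rfl <;> simp
    · rcases sc y hy with rfl | rfl | rfl <;> simp
    · rcases sp y hy with rfl | rfl <;> simp
    · rcases sb y hy with rfl | rfl | rfl <;> simp
    · rcases sd y hy with rfl | rfl | rfl <;> simp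
  obtain ⟨hab, had, hap, hcb, hcd, hcp, hac, hbd, hbp, hdp, nac, nbd, nbp, ndp⟩ := h
  have nca : ¬ G.Adj c a := fun h => nac h.symm
  have nqa : ¬ G.Adj q a := fun h => naq h.symm
  have nqc : ¬ G.Adj q c := fun h => ncq h.symm
  have ndb : ¬ G.Adj d b := fun h => nbd h.symm
  have npb : ¬ G.Adj p b := fun h => nbp h.symm
  have npd : ¬ G.Adj p d := fun h => ndp h.symm
  have e : Nonempty (G ≃g kThreeThreeMinus) := by
    refine nonempty_iso_kThreeThreeMinus (x := ![q, a, c]) (y := ![p, b, d]) ?_ ?_ ?_ ?_ ?_ hqp ?_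
    · have := hac.symm; have := hqa.symm; have := hqc.symm
      intro i j hij
      fin_cases i <;> fin_cases j <;> simp_all
    · have := hbd.symm; have := hbp.symm; have := hdp.symm
      intro i j hij
      fin_cases i <;> fin_cases j <;> simp_all
    · intro i j
      fin_cases i <;> fin_cases j <;> simp [*]
    · intro i j
      fin_cases i <;> fin_cases j <;> simp [*]
    · intro i j
      fin_cases i <;> fin_cases j <;> simp [*]
    · intro z
      rcases Set.eq_univ_iff_forall.1 hall z with rfl | rfl | rfl | rfl | rfl | rfl
      · exact Or.inl ⟨0, rfl⟩
      · exact Or.inl ⟨1, rfl⟩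
      · exact Or.inl ⟨2, rfl⟩
      · exact Or.inr ⟨0, rfl⟩
      · exact Or.inr ⟨1, rfl⟩
      · exact Or.inr ⟨2, rfl⟩
  exact Or.inl (Or.inr (Or.inl ⟨(numDegTwo_congr e.some).trans numDegTwo_kThreeThreeMinus,
    Or.inr (Or.inl e)⟩))

theorem IsTwoThree.isPiece_of_adj (h : IsTwoThree G a c b d p) (hconn : G.Connected)
    (hch : IsChordal 4 G) (hbr : Bridgeless G) (hsub : Subcubic G) (hq : G.Adj b q) (hqa : q ≠ a)
    (hqc : q ≠ c) : IsPiece G := by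
  by_cases hd : G.Adj q d
  · by_cases hp : G.Adj q p
    · exact h.isPiece_of_kThreeThree hconn hsub hq.symm hd hp hqa hqc
    · exact h.isPiece_of_kThreeThreeMinus hconn hch hbr hsub hq.symm hd hp hqa hqc
  · have hp := (h.adj_or_adj hch hbr hsub hq hqa hqc).resolve_left hd
    exact h.rotate.rotate.isPiece_of_kThreeThreeMinus hconn hch hbr hsub hp hq.symm hd hqa hqc

theorem IsTwoThree.isPiece (h : IsTwoThree G a c b d p) (hconn : G.Connected)
    (hch : IsChordal 4 G) (hbr : Bridgeless G) (hsub : Subcubic G) : IsPiece G := by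
  by_contra hcon
  have key : ∀ b d p, IsTwoThree G a c b d p → ∀ q, G.Adj b q → q = a ∨ q = c := by
    intro b d p h q hq
    by_contra! hne
    exact hcon (h.isPiece_of_adj hconn hch hbr hsub hq hne.1 hne.2)
  have hall : {x | x = a ∨ x = c ∨ x = b ∨ x = d ∨ x = p} = Set.univ := by
    refine eq_univ_of_closed hconn ⟨a, Or.inl rfl⟩ ?_
    rintro x (rfl | rfl | rfl | rfl | rfl) y hy
    · rcases h.eq_of_adj hsub y hy with rfl | rfl | rfl <;> simp
    · rcases h.swap.eq_of_adj hsub y hy with rfl | rfl | rfl <;> simp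
    · rcases key _ _ _ h y hy with rfl | rfl <;> simp
    · rcases key _ _ _ h.rotate y hy with rfl | rfl <;> simp
    · rcases key _ _ _ h.rotate.rotate y hy with rfl | rfl <;> simp
  obtain ⟨hab, had, hap, hcb, hcd, hcp, hac, hbd, hbp, hdp, nac, nbd, nbp, ndp⟩ := h
  have nca : ¬ G.Adj c a := fun h => nac h.symm
  have ndb : ¬ G.Adj d b := fun h => nbd h.symm
  have npb : ¬ G.Adj p b := fun h => nbp h.symm
  have npd : ¬ G.Adj p d := fun h => ndp h.symm
  have e : Nonempty (G ≃g completeBipartiteGraph (Fin 2) (Fin 3)) := by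
    refine nonempty_iso_completeBipartiteGraph (x := ![a, c]) (y := ![b, d, p]) ?_ ?_ ?_ ?_ ?_ ?_
    · have := hac.symm
      intro i j hij
      fin_cases i <;> fin_cases j <;> simp_all
    · have := hbd.symm; have := hbp.symm; have := hdp.symm
      intro i j hij
      fin_cases i <;> fin_cases j <;> simp_all
    · intro i j
      fin_cases i <;> fin_cases j <;> simp [*]
    · intro i j
      fin_cases i <;> fin_cases j <;> simp [*]
    · intro i j
      fin_cases i <;> fin_cases j <;> simp [*]
    · intro z
      rcases Set.eq_univ_iff_forall.1 hall z with rfl | rfl | rfl | rfl | rfl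
      · exact Or.inl ⟨0, rfl⟩
      · exact Or.inl ⟨1, rfl⟩
      · exact Or.inr ⟨0, rfl⟩
      · exact Or.inr ⟨1, rfl⟩
      · exact Or.inr ⟨2, rfl⟩
  exact hcon (Or.inl (Or.inr (Or.inr (Or.inl
    ⟨(numDegTwo_congr e.some).trans numDegTwo_completeBipartiteGraph, Or.inr (Or.inl e)⟩))))

/-- Adjacency of `p` to `b` or `d` leads to `diamondPlus`; otherwise `b, d, p` are independent and
`a, c` complete them to an induced `K₂,₃`. -/
theorem IsFourCycle.isPiece_of_opposite (h : IsFourCycle G a b c d)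
    (hconn : G.Connected) (hch : IsChordal 4 G) (hbr : Bridgeless G) (hsub : Subcubic G)
    (hpa : G.Adj p a) (hpc : G.Adj p c) (hpb : p ≠ b) (hpd : p ≠ d) : IsPiece G := by
  by_cases npb : G.Adj p b
  · exact h.isPiece_of_diamondPlus hconn hch hbr hsub hpa npb hpc hpd
  by_cases npd : G.Adj p d
  · exact h.reflect.isPiece_of_diamondPlus hconn hch hbr hsub hpa npd hpc hpb
  exact IsTwoThree.isPiece (a := a) (c := c) (b := b) (d := d) (p := p)
    ⟨h.ab, h.da.symm, hpa.symm, h.bc.symm, h.cd, hpc.symm, h.hac, h.hbd, hpb.symm, hpd.symm,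
      h.nac, h.nbd, fun h' => npb h'.symm, fun h' => npd h'.symm⟩ hconn hch hbr hsub

/-- The neighbours `a` and `w` of `p` are the ends of the induced path `a d c w`, hence at distance
3, against `exists_common`. Distinctness follows from the adjacencies. -/
theorem IsChordal.not_inducedFiveCycle (hch : IsChordal 4 G) {p a d c w : V} (hpa : G.Adj p a)
    (had : G.Adj a d) (hdc : G.Adj d c) (hcw : G.Adj c w) (hwp : G.Adj w p) (npd : ¬ G.Adj p d)
    (npc : ¬ G.Adj p c) (nac : ¬ G.Adj a c) (naw : ¬ G.Adj a w) (ndw : ¬ G.Adj d w) : False := by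
  have hpd : p ≠ d := fun h => ndw (h ▸ hwp.symm)
  have hpc : p ≠ c := fun h => nac (h ▸ hpa.symm)
  have haw : a ≠ w := fun h => ndw (h ▸ had.symm)
  let S : Set V := {x | x = a ∨ x = d ∨ x = c ∨ x = w}
  have hpS : p ∉ S := by
    rintro (h | h | h | h)
    · exact hpa.ne h
    · exact hpd h
    · exact hpc h
    · exact hwp.ne h.symm
  have hcS : c ∈ S := Or.inr (Or.inr (Or.inl rfl))
  have hwS : w ∈ S := Or.inr (Or.inr (Or.inr rfl))
  have hr' : (G.induce S).Reachable ⟨c, hcS⟩ ⟨w, hwS⟩ := Adj.reachable (G := G.induce S) hcw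
  have hdc' : (G.induce S).Reachable ⟨d, Or.inr (Or.inl rfl)⟩ ⟨c, hcS⟩ :=
    Adj.reachable (G := G.induce S) hdc
  have hr : (G.induce S).Reachable ⟨a, Or.inl rfl⟩ ⟨w, hwS⟩ :=
    (Adj.reachable (v := ⟨d, Or.inr (Or.inl rfl)⟩) had).trans (hdc'.trans hr')
  obtain ⟨x, hx, hxa, hpx, hx2⟩ := hch.exists_common hpS _ _ hpa hwp.symm haw hr
  obtain rfl : x = w := by
    rcases hx with rfl | rfl | rfl | rfl
    · exact (hxa rfl).elim
    · exact (npd hpx).elim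
    · exact (npc hpx).elim
    · rfl
  rcases hx2 with h | ⟨y, hy, h1, h2⟩
  · exact naw h
  · rcases hy with rfl | rfl | rfl | rfl
    · exact h1.ne rfl
    · exact ndw h2
    · exact nac h1
    · exact h2.ne rfl

/-- The vertex `p` is not on the cycle `a b c d`. -/
def OffCycle (a b c d p : V) : Prop := p ≠ a ∧ p ≠ b ∧ p ≠ c ∧ p ≠ d

/-- If `a` were the only neighbour of `p` on the cycle, consider the 4-cycle `p a b w`. An edge `wc`
would make `p a d c w` an induced 5-cycle; without it `b` is the only neighbour of `w` on the cycle,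
and `pw` is a third rung. -/
theorem IsFourCycle.adj_consecutive_aux (h : IsFourCycle G a b c d) (hch : IsChordal 4 G)
    (hsub : Subcubic G) (hmax : ∀ f, ¬ IsLadder G 3 f)
    (hno : ∀ p, OffCycle a b c d p → ¬ (G.Adj p a ∧ G.Adj p c) ∧ ¬ (G.Adj p b ∧ G.Adj p d))
    (hp : OffCycle a b c d p) (hpa : G.Adj p a) {w : V} (hbw : G.Adj b w) (hwp : G.Adj w p)
    (hwa : w ≠ a) : G.Adj p b ∨ G.Adj p d := by
  by_contra! hcon
  obtain ⟨npb, npd⟩ := hcon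
  have npc : ¬ G.Adj p c := fun h' => (hno p hp).1 ⟨hpa, h'⟩
  have hw : OffCycle a b c d w := by
    refine ⟨hwa, hbw.ne', ?_, ?_⟩ <;> rintro rfl
    · exact npc hwp.symm
    · exact npd hwp.symm
  have nwd : ¬ G.Adj w d := fun h' => (hno w hw).2 ⟨hbw.symm, h'⟩
  have nwa : ¬ G.Adj w a := fun h' => by
    rcases hsub a b d p w h.ab h.da.symm hpa.symm h'.symm h.hbd hp.2.1.symm hp.2.2.2.symm
      with h1 | h1 | h1
    · exact hw.2.1 h1
    · exact hw.2.2.2 h1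
    · exact hwp.ne h1
  have nwc : ¬ G.Adj w c := fun h' =>
    hch.not_inducedFiveCycle hpa h.da.symm h.cd.symm h'.symm hwp npd npc h.nac
      (fun h => nwa h.symm) (fun h => nwd h.symm)
  -- Written so that `ab` is the last rung, where `extend` attaches `pw`.
  have hl := isLadder_two h.cd.symm h.bc.symm h.ab.symm h.da.symm h.hbd.symm h.hac.symm
    (fun h' => h.nbd h'.symm) (fun h' => h.nac h'.symm)
  refine hmax _ (hl.extend (p := fun s => if s then w else p) ?_ hwp.symm ?_)
  · intro s t i hi
    obtain ⟨h1, h2, h3, h4⟩ := hp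
    obtain ⟨h5, h6, h7, h8⟩ := hw
    dsimp only
    split_ifs <;> assumption
  · intro s t i hi
    have : i = 0 ∨ i = 1 := by omega
    rcases this with rfl | rfl <;> cases s <;> cases t <;>
      simp [*, hbw.symm]

theorem IsFourCycle.adj_consecutive (h : IsFourCycle G a b c d) (hch : IsChordal 4 G)
    (hbr : Bridgeless G) (hsub : Subcubic G) (hmax : ∀ f, ¬ IsLadder G 3 f)
    (hno : ∀ p, OffCycle a b c d p → ¬ (G.Adj p a ∧ G.Adj p c) ∧ ¬ (G.Adj p b ∧ G.Adj p d))
    (hp : OffCycle a b c d p) (hpa : G.Adj p a) : G.Adj p b ∨ G.Adj p d := by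
  have sa : ∀ x, G.Adj a x → x = b ∨ x = d ∨ x = p := fun x hx =>
    hsub a b d p x h.ab h.da.symm hpa.symm hx h.hbd hp.2.1.symm hp.2.2.2.symm
  rcases hch.exists_short_cycle hpa.symm (hbr _ _ hpa.symm) with
    ⟨z, hz1, hz2⟩ | ⟨z, w, h3, h4, h5, h6, h7⟩
  · rcases sa z hz1 with rfl | rfl | rfl
    · exact Or.inl hz2.symm
    · exact Or.inr hz2.symm
    · exact (hz2.ne rfl).elim
  · rcases sa z h3 with rfl | rfl | rfl
    · exact h.adj_consecutive_aux hch hsub hmax hno hp hpa h4 h5 h7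
    · refine (h.reflect.adj_consecutive_aux hch hsub hmax (fun p hp => ?_)
        ⟨hp.1, hp.2.2.2, hp.2.2.1, hp.2.1⟩ hpa h4 h5 h7).symm
      have := hno p ⟨hp.1, hp.2.2.2, hp.2.2.1, hp.2.1⟩
      exact ⟨this.1, fun h => this.2 h.symm⟩
    · exact (h6 rfl).elim

/-- With `p` over the rung `ab`, the vertices `a` and `b` are saturated, so any other outer
neighbour of the cycle is joined to `c` or `d`, hence to both by `adj_consecutive`. The 4-cycle is
thus an `EndAttached` ladder with two rungs. -/
theorem IsFourCycle.isPiece_of_house [Finite V] (h : IsFourCycle G a b c d)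
    (hconn : G.Connected) (hch : IsChordal 4 G)
    (hbr : Bridgeless G) (hsub : Subcubic G) (hmax : ∀ f, ¬ IsLadder G 3 f)
    (hno : ∀ p, OffCycle a b c d p → ¬ (G.Adj p a ∧ G.Adj p c) ∧ ¬ (G.Adj p b ∧ G.Adj p d))
    (hp : OffCycle a b c d p) (hpa : G.Adj p a) (hpb : G.Adj p b) : IsPiece G := by
  have hl := isLadder_two h.ab h.bc h.cd h.da h.hac h.hbd h.nac h.nbd
  refine hl.isPiece_of_endAttached hconn hch hbr hsub le_rfl fun q hq s i hi ha => ?_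
  have hqo : OffCycle a b c d q :=
    ⟨hq false 0 (by omega), hq true 0 (by omega), hq true 1 (by omega), hq false 1 (by omega)⟩
  have first : ∀ q, OffCycle a b c d q → (G.Adj q a ∨ G.Adj q b) → q = p := by
    rintro q hqo (h1 | h1)
    · rcases hsub a b d p q h.ab h.da.symm hpa.symm h1.symm h.hbd hp.2.1.symm hp.2.2.2.symm with
        h2 | h2 | h2
      · exact (hqo.2.1 h2).elim
      · exact (hqo.2.2.2 h2).elim
      · exact h2
    · rcases hsub b a c p q h.ab.symm h.bc hpb.symm h1.symm h.hac hp.1.symm hp.2.2.1.symm with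
        h2 | h2 | h2
      · exact (hqo.1 h2).elim
      · exact (hqo.2.2.1 h2).elim
      · exact h2
  have npc : ¬ G.Adj p c := fun h' => (hno p hp).1 ⟨hpa, h'⟩
  have npd : ¬ G.Adj p d := fun h' => (hno p hp).2 ⟨hpb, h'⟩
  by_cases hqp : q = p
  · subst hqp
    refine Or.inl fun t j hj => ?_
    have : j = 0 ∨ j = 1 := by omega
    rcases this with rfl | rfl <;> cases t <;> simp [*]
  · have nqa : ¬ G.Adj q a := fun h' => hqp (first q hqo (Or.inl h'))
    have nqb : ¬ G.Adj q b := fun h' => hqp (first q hqo (Or.inr h'))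
    have hqcd : G.Adj q c ∧ G.Adj q d := by
      have hcd : G.Adj q c ∨ G.Adj q d := by
        have : i = 0 ∨ i = 1 := by omega
        rcases this with rfl | rfl <;> cases s <;> simp_all
      rcases hcd with hc | hd
      · refine ⟨hc, (h.rotate.rotate.adj_consecutive hch hbr hsub hmax (fun r hr => ?_)
          ⟨hqo.2.2.1, hqo.2.2.2, hqo.1, hqo.2.1⟩ hc).resolve_right nqb⟩
        have := hno r ⟨hr.2.2.1, hr.2.2.2, hr.1, hr.2.1⟩
        exact ⟨fun h => this.1 h.symm, fun h => this.2 h.symm⟩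
      · refine ⟨(h.rotate.rotate.rotate.adj_consecutive hch hbr hsub hmax (fun r hr => ?_)
          ⟨hqo.2.2.2, hqo.1, hqo.2.1, hqo.2.2.1⟩ hd).resolve_left nqa, hd⟩
        have := hno r ⟨hr.2.1, hr.2.2.1, hr.2.2.2, hr.1⟩
        exact ⟨fun h => this.2 h.symm, this.1⟩
    obtain ⟨hqc, hqd⟩ := hqcd
    refine Or.inr fun t j hj => ?_
    have : j = 0 ∨ j = 1 := by omega
    rcases this with rfl | rfl <;> cases t <;> simp [*]

theorem IsFourCycle.isPiece_of_adj [Finite V] (h : IsFourCycle G a b c d)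
    (hconn : G.Connected) (hch : IsChordal 4 G)
    (hbr : Bridgeless G) (hsub : Subcubic G) (hmax : ∀ f, ¬ IsLadder G 3 f)
    (hno : ∀ p, OffCycle a b c d p → ¬ (G.Adj p a ∧ G.Adj p c) ∧ ¬ (G.Adj p b ∧ G.Adj p d))
    (hp : OffCycle a b c d p) (hpa : G.Adj p a) : IsPiece G := by
  rcases h.adj_consecutive hch hbr hsub hmax hno hp hpa with hb | hd
  · exact h.isPiece_of_house hconn hch hbr hsub hmax hno hp hpa hb
  · refine h.reflect.isPiece_of_house hconn hch hbr hsub hmax (fun r hr => ?_)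
      ⟨hp.1, hp.2.2.2, hp.2.2.1, hp.2.1⟩ hpa hd
    have := hno r ⟨hr.1, hr.2.2.2, hr.2.2.1, hr.2.1⟩
    exact ⟨this.1, fun h => this.2 h.symm⟩

theorem IsFourCycle.isPiece [Finite V] (h : IsFourCycle G a b c d)
    (hconn : G.Connected) (hch : IsChordal 4 G)
    (hbr : Bridgeless G) (hsub : Subcubic G) (hmax : ∀ f, ¬ IsLadder G 3 f) : IsPiece G := by
  by_contra hcon
  have hno : ∀ p, OffCycle a b c d p →
      ¬ (G.Adj p a ∧ G.Adj p c) ∧ ¬ (G.Adj p b ∧ G.Adj p d) := by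
    intro p hp
    refine ⟨fun h' => hcon ?_, fun h' => hcon ?_⟩
    · exact h.isPiece_of_opposite hconn hch hbr hsub h'.1 h'.2 hp.2.1 hp.2.2.2
    · exact h.rotate.isPiece_of_opposite hconn hch hbr hsub h'.1 h'.2 hp.2.2.1 hp.1
  have hno' : ∀ p, OffCycle b c d a p →
      ¬ (G.Adj p b ∧ G.Adj p d) ∧ ¬ (G.Adj p c ∧ G.Adj p a) := fun p hp =>
    have := hno p ⟨hp.2.2.2, hp.1, hp.2.1, hp.2.2.1⟩
    ⟨this.2, fun h => this.1 h.symm⟩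
  have hl := isLadder_two h.ab h.bc h.cd h.da h.hac h.hbd h.nac h.nbd
  -- Any outer neighbour already makes `G` a piece, so `EndAttached` holds vacuously; what remains
  -- is the bare 4-cycle, the ladder with two rungs.
  refine hcon (hl.isPiece_of_endAttached hconn hch hbr hsub le_rfl fun q hq s i hi ha =>
    (hcon ?_).elim)
  have hqo : OffCycle a b c d q :=
    ⟨hq false 0 (by omega), hq true 0 (by omega), hq true 1 (by omega), hq false 1 (by omega)⟩
  have : i = 0 ∨ i = 1 := by omega
  obtain ⟨qa, qb, qc, qd⟩ := hqo
  rcases this with rfl | rfl <;> cases s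
  · exact h.isPiece_of_adj hconn hch hbr hsub hmax hno ⟨qa, qb, qc, qd⟩ ha
  · exact h.rotate.isPiece_of_adj hconn hch hbr hsub hmax hno' ⟨qb, qc, qd, qa⟩ ha
  · refine h.rotate.rotate.rotate.isPiece_of_adj hconn hch hbr hsub hmax (fun r hr => ?_)
      ⟨qd, qa, qb, qc⟩ ha
    have := hno' r ⟨hr.2.2.1, hr.2.2.2, hr.1, hr.2.1⟩
    exact ⟨fun h => this.1 h.symm, fun h => this.2 h.symm⟩
  · refine h.rotate.rotate.isPiece_of_adj hconn hch hbr hsub hmax (fun r hr => ?_)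
      ⟨qc, qd, qa, qb⟩ ha
    have := hno r ⟨hr.2.2.1, hr.2.2.2, hr.1, hr.2.1⟩
    exact ⟨fun h => this.1 h.symm, fun h => this.2 h.symm⟩

/-- The structure of connected bridgeless subcubic 4-chordal graphs. -/
theorem isPiece_of_bridgeless [Finite V] (hconn : G.Connected) (hch : IsChordal 4 G)
    (hbr : Bridgeless G) (hsub : Subcubic G) {a b : V} (hab : G.Adj a b) : IsPiece G := by
  obtain ⟨k, f, hk, hf, hmax⟩ := exists_max_ladder hab
  obtain rfl | rfl | hk3 : k = 1 ∨ k = 2 ∨ 3 ≤ k := by omega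
  · exact isPiece_of_no_ladder_two hconn hch hbr hsub hmax hab
  · have h4 : IsFourCycle G (f false 0) (f true 0) (f true 1) (f false 1) := by
      refine ⟨?_, ?_, ?_, ?_, ?_, ?_, ?_, ?_⟩
      any_goals
        rw [hf.adj _ _ _ _ (by omega) (by omega)]
        simp
      · exact hf.ne (by omega) (by omega) (by simp)
      · exact hf.ne (by omega) (by omega) (by simp)
    exact h4.isPiece hconn hch hbr hsub hmax
  · exact hf.isPiece_of_endAttached hconn hch hbr hsub (by omega)
      (hf.endAttached hch hbr hsub hk3 hmax)

end FourCycles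

/-! ### Bridgelessness versus 2-connectedness; bridges from tree edges. -/

section TwoConnected

variable {V : Type u} {G : SimpleGraph V}

theorem mem_of_reachable {S : Set V} {x y : V} (hr : G.Reachable x y) (hx : x ∈ S)
    (hS : ∀ x ∈ S, ∀ y, G.Adj x y → y ∈ S) : y ∈ S := by
  obtain ⟨w⟩ := hr
  induction w with
  | nil => exact hx
  | cons h _ ih => exact ih (hS _ hx _ h)

theorem Bridgeless.exists_adj_ne (hbr : Bridgeless G) {x z : V} (h : G.Adj x z) :
    ∃ w, w ≠ z ∧ G.Adj x w := by
  by_contra! hcon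
  have := mem_of_reachable (S := {x}) (hbr x z h) rfl fun a ha y hy => by
    obtain rfl : a = x := ha
    rw [deleteEdges_adj] at hy
    by_cases hyz : y = z
    · subst hyz; exact absurd rfl hy.2
    · exact (hcon y hyz hy.1).elim
  exact h.ne (this : z = x).symm

/-- From `x` go to a second neighbour `z`, then from `z` to `y` in `G - x`; this avoids the edge
`xy`. -/
theorem IsTwoConnected.bridgeless (h : IsTwoConnected G)
    (hdeg : ∀ x y, G.Adj x y → ∃ z, z ≠ y ∧ G.Adj x z) : Bridgeless G := by
  intro x y hxy
  obtain ⟨z, hzy, hxz⟩ := hdeg x y hxy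
  let φ : G.induce ({x}ᶜ : Set V) →g G.deleteEdges {s(x, y)} :=
    ⟨Subtype.val, by
      intro a b hab
      rw [deleteEdges_adj]
      refine ⟨hab, ?_⟩
      have h1 : (a : V) ≠ x := a.2
      have h2 : (b : V) ≠ x := b.2
      simp only [Set.mem_singleton_iff, Sym2.eq_iff]
      tauto⟩
  have hr := ((h.2.2 x).preconnected ⟨z, hxz.ne'⟩ ⟨y, hxy.ne'⟩).map φ
  refine (Adj.reachable ?_).trans hr
  rw [deleteEdges_adj]
  refine ⟨hxz, ?_⟩
  have h1 : z ≠ y := hzy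
  have h2 := hxy.ne
  change ¬ s(x, z) = s(x, y)
  rw [Sym2.eq_iff]
  tauto

/-- Only `v` links `S` to the rest. Connectedness gives one edge from `v` to `S`, and if it were the
only one it would be a bridge. -/
theorem Bridgeless.exists_two_adj (hbr : Bridgeless G) (hconn : G.Connected) {v x : V}
    {S : Set V} (hx : x ∈ S) (hv : v ∉ S)
    (hS : ∀ a ∈ S, ∀ b, b ≠ v → G.Adj a b → b ∈ S) :
    ∃ a ∈ S, ∃ b ∈ S, a ≠ b ∧ G.Adj v a ∧ G.Adj v b := by
  obtain ⟨a, ha, hva⟩ : ∃ a ∈ S, G.Adj v a := by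
    by_contra! hcon
    refine hv (mem_of_reachable (hconn.preconnected x v) hx fun a ha b hab => ?_)
    refine hS a ha b ?_ hab
    rintro rfl
    exact hcon a ha hab.symm
  by_contra! hcon
  refine hv (mem_of_reachable (hbr v a hva).symm ha fun b hb c hbc => ?_)
  rw [deleteEdges_adj] at hbc
  refine hS b hb c ?_ hbc.1
  rintro rfl
  by_cases hab : a = b
  · subst hab; exact hbc.2 Sym2.eq_swap
  · exact hcon a ha b hb hab hva hbc.1.symm

/-- Two components of `G - v` would each contain two neighbours of `v`, four in all. -/
theorem Bridgeless.isTwoConnected (hbr : Bridgeless G) (hconn : G.Connected) (hsub : Subcubic G)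
    (hcard : 3 ≤ Nat.card V) : IsTwoConnected G := by
  refine ⟨hcard, hconn, fun v => ?_⟩
  have : Nontrivial V := by
    have : Finite V := Nat.finite_of_card_ne_zero (by omega)
    exact Finite.one_lt_card_iff_nontrivial.1 (by omega)
  obtain ⟨w, hw⟩ := exists_ne v
  have : Nonempty ({v}ᶜ : Set V) := ⟨⟨w, hw⟩⟩
  refine ⟨fun x y => ?_⟩
  by_contra hxy
  let C : ({v}ᶜ : Set V) → Set V := fun x =>
    {z | ∃ hz : z ∈ ({v}ᶜ : Set V), (G.induce ({v}ᶜ : Set V)).Reachable x ⟨z, hz⟩}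
  have hC : ∀ x, ∃ a ∈ C x, ∃ b ∈ C x, a ≠ b ∧ G.Adj v a ∧ G.Adj v b := by
    intro x
    refine hbr.exists_two_adj (x := (x : V)) hconn ⟨x.2, .rfl⟩ (fun ⟨h, _⟩ => h rfl) ?_
    rintro a ⟨ha, hxa⟩ b hb hab
    exact ⟨hb, hxa.trans (Adj.reachable hab)⟩
  have hdisj : ∀ z, z ∈ C x → z ∉ C y := fun z ⟨_, h1⟩ ⟨_, h2⟩ => hxy (h1.trans h2.symm)
  obtain ⟨a, ha, b, hb, hab, hva, hvb⟩ := hC x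
  obtain ⟨c, hc, d, hd, hcd, hvc, hvd⟩ := hC y
  rcases hsub v a b c d hva hvb hvc hvd hab (fun h => hdisj a ha (h ▸ hc))
    (fun h => hdisj b hb (h ▸ hc)) with h | h | h
  · exact hdisj a ha (h ▸ hd)
  · exact hdisj b hb (h ▸ hd)
  · exact hcd h.symm

/-- An edge `tt'` of the tree is a bridge, and the edge of `G` over it inherits this: a walk
avoiding it projects to a walk in `T` avoiding `tt'`. -/
theorem ArisesFromTree.not_bridgeless (h : ArisesFromTree G) : ¬ Bridgeless G := by
  classical
  obtain ⟨W, _, T, hT, hcard, -, U, H, p, -, ⟨e⟩⟩ := h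
  intro hbr
  have : Nontrivial W := Fintype.one_lt_card_iff_nontrivial.1 hcard
  obtain ⟨t⟩ := hT.connected.nonempty
  obtain ⟨t', htt'⟩ : ∃ t', T.Adj t t' := hT.connected.preconnected.exists_adj_of_nontrivial t
  have hbT := isAcyclic_iff_forall_adj_isBridge.1 hT.isAcyclic htt'
  rw [isBridge_iff] at hbT
  let x := e.symm ⟨t, p t t'⟩
  let y := e.symm ⟨t', p t' t⟩
  have hxy : G.Adj x y := e.symm.map_adj_iff.2 (Or.inr ⟨htt', rfl, rfl⟩)
  have := mem_of_reachable (S := {z | (T.deleteEdges {s(t, t')}).Reachable t (e z).1})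
    (hbr x y hxy) (by simp [x]) ?_
  · refine hbT ?_
    simpa [y] using this
  · intro a ha b hab
    rw [deleteEdges_adj] at hab
    obtain ⟨hab, hne⟩ := hab
    have ha' : (T.deleteEdges {s(t, t')}).Reachable t (e a).1 := ha
    change (T.deleteEdges {s(t, t')}).Reachable t (e b).1
    rcases e.map_adj_iff.2 hab with ⟨s, u, w, -, h1, h2⟩ | ⟨h1, h2, h3⟩
    · rw [h1] at ha'
      rw [h2]
      exact ha'
    · refine ha'.trans (Adj.reachable ?_)
      rw [deleteEdges_adj]
      refine ⟨h1, fun hs => hne ?_⟩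
      have hs' : s((e a).1, (e b).1) = s(t, t') := hs
      -- The attachment function fixes both ends, so `xy` is the only edge of `G` over `tt'`.
      have key : ∀ a t t', (e a).1 = t → (e a).2 = p (e a).1 t' → a = e.symm ⟨t, p t t'⟩ := by
        rintro a t t' rfl h
        rw [e.eq_symm_apply, ← h]
      rcases Sym2.eq_iff.1 hs' with ⟨h4, h5⟩ | ⟨h4, h5⟩
      · have e1 : a = x := key a t t' h4 (h5 ▸ h2)
        have e2 : b = y := key b t' t h5 (h4 ▸ h3)
        rw [e1, e2]; rfl
      · have e1 : a = y := key a t' t h4 (h5 ▸ h2)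
        have e2 : b = x := key b t t' h5 (h4 ▸ h3)
        rw [e1, e2]; exact Sym2.eq_swap

end TwoConnected

/-! ### The tree of bridgeless components and the substitution structure. -/

section BridgeTree

variable {V : Type u} {G : SimpleGraph V}

/-- The graph without its bridges. -/
def bridgeFree (G : SimpleGraph V) : SimpleGraph V := G.deleteEdges {e | G.IsBridge e}

theorem bridgeFree_le : bridgeFree G ≤ G := deleteEdges_le _

theorem bridgeFree_adj {x y : V} : (bridgeFree G).Adj x y ↔ G.Adj x y ∧ ¬ G.IsBridge s(x, y) :=
  deleteEdges_adj

/-- The component of `x` in the graph without its bridges. -/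
def block (G : SimpleGraph V) (x : V) : (bridgeFree G).ConnectedComponent :=
  (bridgeFree G).connectedComponentMk x

theorem block_eq_iff {x y : V} : block G x = block G y ↔ (bridgeFree G).Reachable x y :=
  ConnectedComponent.eq

theorem exists_block_eq (c : (bridgeFree G).ConnectedComponent) : ∃ x, block G x = c :=
  c.exists_rep

theorem isBridge_of_block_ne {x y : V} (h : G.Adj x y) (hne : block G x ≠ block G y) :
    G.IsBridge s(x, y) := by
  by_contra hcon
  exact hne (block_eq_iff.2 (Adj.reachable (bridgeFree_adj.2 ⟨h, hcon⟩)))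

theorem reachable_delete_of_block_eq {x y a b : V} (h : block G a = block G b)
    (hxy : G.IsBridge s(x, y)) : (G.deleteEdges {s(x, y)}).Reachable a b := by
  refine (block_eq_iff.1 h).mono ?_
  intro u v huv
  rw [bridgeFree_adj] at huv
  rw [deleteEdges_adj]
  refine ⟨huv.1, ?_⟩
  rintro h
  rw [Set.mem_singleton_iff] at h
  exact huv.2 (h ▸ hxy)

theorem block_ne_of_isBridge {x y : V} (h : G.IsBridge s(x, y)) : block G x ≠ block G y :=
  fun he => isBridge_iff.1 h (reachable_delete_of_block_eq he h)

/-- Of two edges between the same two blocks, each would bypass the other, although both are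
bridges. This makes the attachment vertices well defined. -/
theorem bridge_unique {x y x' y' : V} (h : G.Adj x y) (h' : G.Adj x' y')
    (hx : block G x = block G x') (hy : block G y = block G y') (hne : block G x ≠ block G y) :
    x' = x ∧ y' = y := by
  have hb := isBridge_of_block_ne h hne
  by_cases he : s(x', y') = s(x, y)
  · rcases Sym2.eq_iff.1 he with h1 | ⟨rfl, rfl⟩
    · exact h1
    · exact (hne hx).elim
  · refine (isBridge_iff.1 hb ?_).elim
    exact (reachable_delete_of_block_eq hx hb).trans
      ((Adj.reachable (deleteEdges_adj.2 ⟨h', he⟩)).trans (reachable_delete_of_block_eq hy.symm hb))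

/-- The tree obtained by contracting the components left by removing all bridges. -/
def bridgeTree (G : SimpleGraph V) : SimpleGraph (bridgeFree G).ConnectedComponent where
  Adj c d := c ≠ d ∧ ∃ x y, block G x = c ∧ block G y = d ∧ G.Adj x y
  symm := ⟨fun _ _ ⟨hne, x, y, hx, hy, h⟩ => ⟨hne.symm, y, x, hy, hx, h.symm⟩⟩
  loopless := ⟨fun _ h => h.1 rfl⟩

theorem bridgeTree_adj {x y : V} (h : G.Adj x y) (hne : block G x ≠ block G y) :
    (bridgeTree G).Adj (block G x) (block G y) := ⟨hne, x, y, rfl, rfl, h⟩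

/-- Walks in `G` project to the quotient, which is therefore connected. Conversely, a walk avoiding
a tree edge lifts to a walk in `G` avoiding the bridge over it, since blocks stay connected without
that bridge. -/
theorem bridgeTree_isTree (hconn : G.Connected) : (bridgeTree G).IsTree := by
  refine ⟨?_, ?_⟩
  · have := hconn.nonempty
    obtain ⟨v⟩ := this
    have : Nonempty (bridgeFree G).ConnectedComponent := ⟨block G v⟩
    refine ⟨fun c d => ?_⟩
    obtain ⟨x, rfl⟩ := exists_block_eq c
    obtain ⟨y, rfl⟩ := exists_block_eq d
    refine mem_of_reachable (S := {z | (bridgeTree G).Reachable (block G x) (block G z)})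
      (hconn.preconnected x y) .rfl fun a ha b hab => ?_
    change (bridgeTree G).Reachable (block G x) (block G b)
    by_cases he : block G a = block G b
    · rw [← he]; exact ha
    · exact Reachable.trans ha (Adj.reachable (bridgeTree_adj hab he))
  · rw [isAcyclic_iff_forall_adj_isBridge]
    rintro c d ⟨hne, x, y, rfl, rfl, hxy⟩
    have hb := isBridge_of_block_ne hxy hne
    rw [isBridge_iff]
    intro hr
    refine isBridge_iff.1 hb ?_
    refine mem_of_reachable
      (S := {c' | ∀ z, block G z = c' → (G.deleteEdges {s(x, y)}).Reachable x z}) hr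
      (fun z hz => reachable_delete_of_block_eq hz.symm hb) ?_ y rfl
    intro c' hc' d' hcd z hz
    rw [deleteEdges_adj] at hcd
    obtain ⟨⟨hne', u, w, rfl, rfl, huw⟩, hcd⟩ := hcd
    refine (hc' u rfl).trans ((Adj.reachable ?_).trans (reachable_delete_of_block_eq hz.symm hb))
    refine deleteEdges_adj.2 ⟨huw, fun he => hcd ?_⟩
    have he' : s(u, w) = s(x, y) := he
    change s(block G u, block G w) = s(block G x, block G y)
    rcases Sym2.eq_iff.1 he' with ⟨rfl, rfl⟩ | ⟨rfl, rfl⟩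
    · rfl
    · exact Sym2.eq_swap

/-- The component `c` as an induced subgraph of `G`. -/
def blockGraph (G : SimpleGraph V) (c : (bridgeFree G).ConnectedComponent) :
    SimpleGraph {x // block G x = c} := G.induce {x | block G x = c}

theorem blockGraph_adj {c : (bridgeFree G).ConnectedComponent} {x y : {x // block G x = c}} :
    (blockGraph G c).Adj x y ↔ G.Adj x y := Iff.rfl

theorem blockGraph_connected (c : (bridgeFree G).ConnectedComponent) :
    (blockGraph G c).Connected := by
  have h : ((bridgeFree G).induce {x | block G x = c}).Connected := c.connected_toSimpleGraph
  exact Connected.mono (fun x y hxy => bridgeFree_le (G := G) hxy) h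

/-- An edge inside a block is not a bridge of `G`, so it lies on a cycle. A cycle contains no
bridge, hence it survives in `bridgeFree G` and stays inside the block. -/
theorem blockGraph_bridgeless (c : (bridgeFree G).ConnectedComponent) :
    Bridgeless (blockGraph G c) := by
  intro a b hab
  have hnb : ¬ G.IsBridge s((a : V), (b : V)) := fun h =>
    block_ne_of_isBridge h (a.2.trans b.2.symm)
  rw [isBridge_iff, not_not] at hnb
  obtain ⟨u, q, hq, he⟩ := adj_and_reachable_delete_edges_iff_exists_cycle.1
    ⟨blockGraph_adj.1 hab, hnb⟩
  have hedge : ∀ e ∈ q.edges, e ∈ (bridgeFree G).edgeSet := by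
    intro e heq
    rw [bridgeFree, edgeSet_deleteEdges]
    exact ⟨q.edges_subset_edgeSet heq, fun hb => IsBridge.notMem_edges_of_isCycle hb hq heq⟩
  have hr := (adj_and_reachable_delete_edges_iff_exists_cycle.2
    ⟨u, q.transfer _ hedge, hq.transfer hedge, by rwa [Walk.edges_transfer]⟩).2
  have hmem := mem_of_reachable (S := {z | ∃ hz : block G z = c,
    ((blockGraph G c).deleteEdges {s(a, b)}).Reachable a ⟨z, hz⟩}) hr ⟨a.2, .rfl⟩ ?_
  · exact hmem.choose_spec
  · rintro x ⟨hx, hax⟩ y hxy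
    rw [deleteEdges_adj] at hxy
    have hy : block G y = c := by
      rw [← hx, block_eq_iff]; exact (Adj.reachable hxy.1).symm
    refine ⟨hy, hax.trans (Adj.reachable ?_)⟩
    refine deleteEdges_adj.2 ⟨(bridgeFree_adj.1 hxy.1).1, fun h => hxy.2 ?_⟩
    have h' : s((⟨x, hx⟩ : {x // block G x = c}), ⟨y, hy⟩) = s(a, b) := h
    change s(x, y) = s((a : V), (b : V))
    rcases Sym2.eq_iff.1 h' with ⟨rfl, rfl⟩ | ⟨rfl, rfl⟩
    · rfl
    · exact Sym2.eq_swap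

/-- The attachment function of the bridge tree. -/
theorem exists_attachment (G : SimpleGraph V) :
    ∃ p : (c : (bridgeFree G).ConnectedComponent) → (bridgeFree G).ConnectedComponent →
        {x // block G x = c},
      ∀ c d x y, block G x = c → block G y = d → c ≠ d → G.Adj x y → (p c d : V) = x := by
  have : ∀ c d : (bridgeFree G).ConnectedComponent, ∃ u : {x // block G x = c},
      ∀ x y, block G x = c → block G y = d → c ≠ d → G.Adj x y → (u : V) = x := by
    intro c d
    by_cases h : ∃ x y, block G x = c ∧ block G y = d ∧ c ≠ d ∧ G.Adj x y
    · obtain ⟨x, y, rfl, rfl, hne, hxy⟩ := h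
      refine ⟨⟨x, rfl⟩, fun x' y' hx hy _ h => ?_⟩
      exact (bridge_unique hxy h hx.symm hy.symm hne).1.symm
    -- No edge joins the two blocks, so the value is arbitrary.
    · obtain ⟨x, hx⟩ := exists_block_eq c
      refine ⟨⟨x, hx⟩, fun x' y' hx hy hne hxy => (h ⟨x', y', hx, hy, hne, hxy⟩).elim⟩
  choose p hp using this
  exact ⟨p, hp⟩

variable {p : (c : (bridgeFree G).ConnectedComponent) → (bridgeFree G).ConnectedComponent →
    {x // block G x = c}}

theorem nonempty_iso_substitute
    (hp : ∀ c d x y, block G x = c → block G y = d → c ≠ d → G.Adj x y → (p c d : V) = x) :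
    Nonempty (G ≃g substitute (bridgeTree G) (blockGraph G) p) := by
  refine ⟨⟨(Equiv.sigmaFiberEquiv (block G)).symm, ?_⟩⟩
  intro x y
  change (substitute (bridgeTree G) (blockGraph G) p).Adj ⟨block G x, ⟨x, rfl⟩⟩
    ⟨block G y, ⟨y, rfl⟩⟩ ↔ G.Adj x y
  have hs : ∀ (c : (bridgeFree G).ConnectedComponent) (z : V) (u : {x // block G x = c}),
      (⟨block G z, ⟨z, rfl⟩⟩ : Σ c, {x // block G x = c}) = ⟨c, u⟩ ↔ z = u := by
    rintro c z ⟨u, rfl⟩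
    constructor
    · intro h
      exact congrArg (fun a : Σ c, {x // block G x = c} => (a.2 : V)) h
    · rintro (rfl : z = u); rfl
  constructor
  · rintro (⟨c, u, w, huw, h1, h2⟩ | ⟨⟨hne, u, w, hu, hw, huw⟩, h2, h3⟩)
    · rw [hs] at h1 h2
      rw [h1, h2]; exact huw
    · have e1 := hp _ _ u w hu hw hne huw
      have e2 := hp _ _ w u hw hu hne.symm huw.symm
      have e3 : x = u := (congrArg Subtype.val h2).trans e1
      have e4 : y = w := (congrArg Subtype.val h3).trans e2
      rw [e3, e4]; exact huw
  · intro hxy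
    by_cases he : block G x = block G y
    · exact Or.inl ⟨block G x, ⟨x, rfl⟩, ⟨y, he.symm⟩, hxy, rfl, (hs _ _ _).2 rfl⟩
    · refine Or.inr ⟨bridgeTree_adj hxy he, Subtype.ext ?_, Subtype.ext ?_⟩
      · exact (hp _ _ x y rfl rfl he hxy).symm
      · exact (hp _ _ y x rfl rfl (Ne.symm he) hxy.symm).symm

/-- A block with a single vertex keeps its degree: by `bridge_unique` its neighbours lie in
different blocks. -/
theorem ncard_neighborSet_bridgeTree_of_unique {x : V}
    (hu : ∀ y, block G y = block G x → y = x) :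
    ((bridgeTree G).neighborSet (block G x)).ncard = (G.neighborSet x).ncard := by
  have hb : ∀ y, G.Adj x y → block G x ≠ block G y := fun y hy he => hy.ne' (hu y he.symm)
  have : (bridgeTree G).neighborSet (block G x) = block G '' G.neighborSet x := by
    ext d
    constructor
    · rintro ⟨hne, u, w, hux, rfl, huw⟩
      rw [hu u hux] at huw
      exact ⟨w, huw, rfl⟩
    · rintro ⟨y, hy, rfl⟩
      exact bridgeTree_adj hy (hb y hy)
  rw [this, Set.InjOn.ncard_image]
  intro y hy z hz hyz
  exact (bridge_unique (show G.Adj x z from hz) (show G.Adj x y from hy) rfl hyz.symm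
    (hb z hz)).2

/-- In a nontrivial block, bridgelessness provides two neighbours `z`, `w` within the block; only
the third, `y`, may lie outside. -/
theorem exists_three_neighbors [Finite V] (hcubic : ∀ v, (G.neighborSet v).ncard = 3)
    {c : (bridgeFree G).ConnectedComponent} (hc : ∃ x y : {x // block G x = c}, x ≠ y)
    (x : {x // block G x = c}) :
    ∃ (z w : {x // block G x = c}) (y : V), z ≠ w ∧ (z : V) ≠ y ∧ (w : V) ≠ y ∧
      ∀ v, G.Adj x v ↔ v = z ∨ v = w ∨ v = y := by
  have : Nontrivial {x // block G x = c} := by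
    obtain ⟨a, b, hab⟩ := hc
    exact ⟨a, b, hab⟩
  obtain ⟨z, hz⟩ := (blockGraph_connected c).preconnected.exists_adj_of_nontrivial x
  obtain ⟨w, hwz, hw⟩ := (blockGraph_bridgeless c).exists_adj_ne hz
  have hzG : (z : V) ∈ G.neighborSet x := hz
  have hwG : (w : V) ∈ G.neighborSet x := hw
  obtain ⟨a, b, d, hab, had, hbd, hN⟩ := Set.ncard_eq_three.1 (hcubic x)
  have hadj : ∀ v, G.Adj x v ↔ v = a ∨ v = b ∨ v = d := by
    intro v
    rw [← mem_neighborSet, hN]; simp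
  have hne : (z : V) ≠ w := fun h => hwz (Subtype.ext h.symm)
  rcases (hadj z).1 hz with h1 | h1 | h1 <;> rcases (hadj w).1 hw with h2 | h2 | h2
  · exact (hne (h1.trans h2.symm)).elim
  · exact ⟨z, w, d, hwz.symm, h1 ▸ had, h2 ▸ hbd, fun v => by rw [hadj, h1, h2]⟩
  · exact ⟨z, w, b, hwz.symm, h1 ▸ hab, h2 ▸ hbd.symm, fun v => by rw [hadj, h1, h2]; tauto⟩
  · exact ⟨z, w, d, hwz.symm, h1 ▸ hbd, h2 ▸ had, fun v => by rw [hadj, h1, h2]; tauto⟩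
  · exact (hne (h1.trans h2.symm)).elim
  · exact ⟨z, w, a, hwz.symm, h1 ▸ hab.symm, h2 ▸ had.symm,
      fun v => by rw [hadj, h1, h2]; tauto⟩
  · exact ⟨z, w, b, hwz.symm, h1 ▸ hbd.symm, h2 ▸ hab, fun v => by rw [hadj, h1, h2]; tauto⟩
  · exact ⟨z, w, a, hwz.symm, h1 ▸ had.symm, h2 ▸ hab.symm,
      fun v => by rw [hadj, h1, h2]; tauto⟩
  · exact (hne (h1.trans h2.symm)).elim

/-- A vertex has degree 2 in its block exactly when its third neighbour lies outside, and this
unique outside neighbour determines the adjacent block. -/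
theorem bijOn_attachment [Finite V] (hcubic : ∀ v, (G.neighborSet v).ncard = 3)
    (hp : ∀ c d x y, block G x = c → block G y = d → c ≠ d → G.Adj x y → (p c d : V) = x)
    {c : (bridgeFree G).ConnectedComponent} (hc : ∃ x y : {x // block G x = c}, x ≠ y) :
    Set.BijOn (p c) ((bridgeTree G).neighborSet c)
      {x | ((blockGraph G c).neighborSet x).ncard = 2} := by
  have hspec : ∀ d, (bridgeTree G).Adj c d → ∃ y, block G y = d ∧ G.Adj (p c d) y := by
    rintro d ⟨hne, x, y, hx, hy, hxy⟩
    exact ⟨y, hy, by rwa [hp c d x y hx hy hne hxy]⟩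
  have huniq : ∀ (x : {x // block G x = c}) (y y' : V), G.Adj x y → G.Adj x y' → block G y ≠ c →
      block G y' ≠ c → y = y' := by
    intro x y y' hy hy' hyc hyc'
    obtain ⟨z, w, v, -, -, -, hN⟩ := exists_three_neighbors hcubic hc x
    rcases (hN y).1 hy with rfl | rfl | rfl
    · exact (hyc z.2).elim
    · exact (hyc w.2).elim
    · rcases (hN y').1 hy' with rfl | rfl | rfl
      · exact (hyc' z.2).elim
      · exact (hyc' w.2).elim
      · rfl
  refine ⟨?_, ?_, ?_⟩
  · intro d hd
    obtain ⟨y, rfl, hy⟩ := hspec d hd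
    obtain ⟨z, w, v, hzw, -, -, hN⟩ := exists_three_neighbors hcubic hc (p c (block G y))
    have hyc : block G y ≠ c := fun h => (bridgeTree G).ne_of_adj hd h.symm
    have hyv : y = v := by
      rcases (hN y).1 hy with rfl | rfl | rfl
      · exact (hyc z.2).elim
      · exact (hyc w.2).elim
      · rfl
    refine ncard_neighborSet_eq_two hzw fun u => ?_
    rw [blockGraph_adj, hN, Subtype.ext_iff, Subtype.ext_iff]
    constructor
    · rintro (h | h | h)
      · exact Or.inl h
      · exact Or.inr h
      · exact (hyc (by rw [hyv, ← h]; exact u.2)).elim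
    · rintro (h | h)
      · exact Or.inl h
      · exact Or.inr (Or.inl h)
  · intro d hd d' hd' he
    obtain ⟨y, rfl, hy⟩ := hspec d hd
    obtain ⟨y', rfl, hy'⟩ := hspec d' hd'
    rw [← he] at hy'
    rw [huniq _ y y' hy hy' (fun h => (bridgeTree G).ne_of_adj hd h.symm)
      (fun h => (bridgeTree G).ne_of_adj hd' h.symm)]
  · intro x hx
    obtain ⟨z, w, y, hzw, hzy, hwy, hN⟩ := exists_three_neighbors hcubic hc x
    have hyc : block G y ≠ c := by
      intro h
      refine ncard_neighborSet_ne_two (G := blockGraph G c) (x := x) (a := z) (b := w)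
        (c := ⟨y, h⟩) ?_ ?_ ?_ hzw ?_ ?_ hx
      · exact (hN z).2 (Or.inl rfl)
      · exact (hN w).2 (Or.inr (Or.inl rfl))
      · exact (hN y).2 (Or.inr (Or.inr rfl))
      · exact fun h => hzy (congrArg Subtype.val h)
      · exact fun h => hwy (congrArg Subtype.val h)
    have hxy : G.Adj x y := (hN y).2 (Or.inr (Or.inr rfl))
    exact ⟨block G y, ⟨hyc.symm, x, y, x.2, rfl, hxy⟩,
      Subtype.ext (hp _ _ x y x.2 rfl hyc.symm hxy)⟩

theorem degree_eq_ncard {W : Type*} {T : SimpleGraph W} (t : W) [Fintype (T.neighborSet t)] :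
    T.degree t = (T.neighborSet t).ncard := by
  rw [← card_neighborSet_eq_degree, ← Nat.card_eq_fintype_card, Set.ncard_def, Nat.card]
  rfl

theorem subcubic_blockGraph (hsub : Subcubic G) (c : (bridgeFree G).ConnectedComponent) :
    Subcubic (blockGraph G c) := by
  intro v x y z w hx hy hz hw hxy hxz hyz
  have := hsub v x y z w hx hy hz hw (fun h => hxy (Subtype.ext h)) (fun h => hxz (Subtype.ext h))
    (fun h => hyz (Subtype.ext h))
  simpa only [Subtype.ext_iff] using this

theorem numDegTwo_completeGraph_four : numDegTwo (completeGraph (Fin 4)) = 0 := by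
  rw [numDegTwo_eq_card]; decide

theorem numDegTwo_completeBipartiteGraph_three :
    numDegTwo (completeBipartiteGraph (Fin 3) (Fin 3)) = 0 := by
  let _ : DecidableRel (completeBipartiteGraph (Fin 3) (Fin 3)).Adj :=
    fun x y => decidable_of_iff (x.isLeft ≠ y.isLeft) (by
      rcases x with x | x <;> rcases y with y | y <;> simp)
  rw [numDegTwo_eq_card]; decide

theorem numDegTwo_prism : numDegTwo (pathGraph 2 □ completeGraph (Fin 3)) = 0 := by
  let _ : DecidableRel (pathGraph 2 □ completeGraph (Fin 3)).Adj :=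
    fun x y => decidable_of_iff ((x.1 ≠ y.1 ∧ x.2 = y.2) ∨ (x.2 ≠ y.2 ∧ x.1 = y.1)) (by
      rw [boxProd_adj, pathGraph_two_eq_top]; rfl)
  rw [numDegTwo_eq_card]; decide

/-- The three exceptional pieces are cubic, so they leave no vertex at which a bridge could attach.
-/
theorem IsPiece.isReplacement (h : IsPiece G) (h0 : numDegTwo G ≠ 0) :
    IsReplacement (numDegTwo G) G := by
  rcases h with h | ⟨⟨e⟩⟩ | ⟨⟨e⟩⟩ | ⟨⟨e⟩⟩
  · exact h
  · exact (h0 ((numDegTwo_congr e).trans numDegTwo_completeGraph_four)).elim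
  · exact (h0 ((numDegTwo_congr e).trans numDegTwo_completeBipartiteGraph_three)).elim
  · exact (h0 ((numDegTwo_congr e).trans numDegTwo_prism)).elim

/-- A bridge makes the bridge tree nontrivial, so every block has positive tree degree; for
nontrivial blocks this degree equals `numDegTwo` by `bijOn_attachment`. The bound 4 on the maximum
degree is read off from the classification. -/
theorem arisesFromTree_of_not_bridgeless [Finite V] (hconn : G.Connected)
    (hcubic : ∀ v, (G.neighborSet v).ncard = 3) (hch : IsChordal 4 G) (hbr : ¬ Bridgeless G) :
    ArisesFromTree G := by
  classical
  have hsub : Subcubic G := subcubic_of_ncard_le fun v => (hcubic v).le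
  have hfin : Finite (bridgeFree G).ConnectedComponent :=
    Finite.of_surjective (block G) exists_block_eq
  have hnt : Nontrivial (bridgeFree G).ConnectedComponent := by
    simp only [Bridgeless, not_forall] at hbr
    obtain ⟨a, b, hab, hr⟩ := hbr
    exact ⟨_, _, block_ne_of_isBridge (isBridge_iff.2 hr)⟩
  have : Fintype (bridgeFree G).ConnectedComponent := Fintype.ofFinite _
  have hT := bridgeTree_isTree hconn
  obtain ⟨p, hp⟩ := exists_attachment G
  have hmain : ∀ t, ((bridgeTree G).degree t = 3 ∧ Nonempty (Unique {x // block G x = t})) ∨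
      (IsReplacement ((bridgeTree G).degree t) (blockGraph G t) ∧
        Set.BijOn (p t) ((bridgeTree G).neighborSet t)
          {x | ((blockGraph G t).neighborSet x).ncard = 2}) := by
    intro t
    by_cases ht : ∃ x y : {x // block G x = t}, x ≠ y
    · have hbij := bijOn_attachment hcubic hp ht
      have hdeg : (bridgeTree G).degree t = numDegTwo (blockGraph G t) := by
        rw [degree_eq_ncard, hbij.ncard_eq]; rfl
      obtain ⟨d, hd⟩ := hT.connected.preconnected.exists_adj_of_nontrivial t
      have hpos : (bridgeTree G).degree t ≠ 0 := by
        have := (degree_pos_iff_exists_adj (bridgeTree G) t).2 ⟨d, hd⟩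
        omega
      have hnt' : Nontrivial {x // block G x = t} := ⟨ht⟩
      obtain ⟨y, hxy⟩ :=
        (blockGraph_connected t).preconnected.exists_adj_of_nontrivial ht.choose
      have hpiece := isPiece_of_bridgeless (blockGraph_connected t) (hch.induce _)
        (blockGraph_bridgeless t) (subcubic_blockGraph hsub t) hxy
      refine Or.inr ⟨?_, hbij⟩
      rw [hdeg] at hpos ⊢
      exact hpiece.isReplacement hpos
    · obtain ⟨x, rfl⟩ := exists_block_eq t
      push Not at ht
      refine Or.inl ⟨?_, ⟨⟨⟨⟨x, rfl⟩⟩, fun y => ht _ _⟩⟩⟩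
      rw [degree_eq_ncard, ncard_neighborSet_bridgeTree_of_unique, hcubic]
      intro y hy
      exact congrArg Subtype.val (ht ⟨y, hy⟩ ⟨x, rfl⟩)
  refine ⟨_, this, bridgeTree G, hT, Fintype.one_lt_card_iff_nontrivial.2 hnt, ?_,
    fun t => {x // block G x = t}, blockGraph G, p, ?_, nonempty_iso_substitute hp⟩
  · refine maxDegree_le_of_forall_degree_le _ _ fun t => ?_
    rcases hmain t with ⟨h, -⟩ | ⟨⟨h, -⟩ | ⟨h, -⟩ | ⟨h, -⟩ | ⟨h, -⟩, -⟩ <;> omega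
  · intro t
    convert hmain t

end BridgeTree

end CubicChordal

/-! ### The dichotomy. -/

theorem corollary1 {V : Type u} [Fintype V] (G : SimpleGraph V) [DecidableRel G.Adj]
    (hconn : G.Connected) (hcubic : G.IsRegularOfDegree 3)
    (hchord : CubicChordal.IsChordal 4 G) :
    (CubicChordal.IsTwoConnected G →
      Nonempty (G ≃g completeGraph (Fin 4)) ∨
      Nonempty (G ≃g completeBipartiteGraph (Fin 3) (Fin 3)) ∨
      Nonempty (G ≃g pathGraph 2 □ completeGraph (Fin 3))) ∧
    (¬ CubicChordal.IsTwoConnected G ↔ CubicChordal.ArisesFromTree G) := by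
  have hcub : ∀ v, (G.neighborSet v).ncard = 3 := fun v => by
    rw [← CubicChordal.degree_eq_ncard, hcubic v]
  have hsub : CubicChordal.Subcubic G :=
    CubicChordal.subcubic_of_ncard_le fun v => (hcub v).le
  have hdeg : ∀ x y, G.Adj x y → ∃ z, z ≠ y ∧ G.Adj x z := by
    intro x y _
    obtain ⟨z, hz, hzy⟩ := Set.exists_ne_of_one_lt_ncard (s := G.neighborSet x)
      (by rw [hcub]; omega) y
    exact ⟨z, hzy, hz⟩
  refine ⟨fun h2 => ?_, fun h2 => ?_, fun h2 h => h2.not_bridgeless (h.bridgeless hdeg)⟩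
  · obtain ⟨v⟩ := hconn.nonempty
    obtain ⟨w, hw⟩ := (Set.ncard_pos (Set.toFinite _)).1 (by rw [hcub v]; omega)
    -- A cubic graph has no vertex of degree 2, whereas `IsReplacement` needs a degree between 1 and
    -- 4; only the three cubic pieces remain.
    have h0 : CubicChordal.numDegTwo G = 0 := by
      simp [CubicChordal.numDegTwo, hcub]
    rcases CubicChordal.isPiece_of_bridgeless hconn hchord (h2.bridgeless hdeg) hsub
      (show G.Adj v w from hw) with h | h
    · rw [h0] at h
      rcases h with ⟨h, -⟩ | ⟨h, -⟩ | ⟨h, -⟩ | ⟨h, -⟩ <;> omega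
    · exact h
  · refine CubicChordal.arisesFromTree_of_not_bridgeless hconn hcub hchord fun hbr => h2 ?_
    refine hbr.isTwoConnected hconn hsub ?_
    obtain ⟨v⟩ := hconn.nonempty
    rw [← hcub v, ← Set.ncard_univ]
    exact Set.ncard_le_ncard (Set.subset_univ _)
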